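/- All graphs are finite and simple. The spectral radius $\lambda(G)$ of a graph $G$ is the largest modulus of an eigenvalue of its adjacency matrix. For $r\ge 2$, let $\theta_{1,2,r}$ be the graph formed by connecting two distinct vertices with three internally disjoint paths of lengths (numbers of edges) $1$, $2$ and $r$. A graph is $F$-free if it has no (not necessarily induced) subgraph isomorphic to $F$. Let $S_{n,2}=K_2\vee (n-2)K_1$, the graph obtained from the disjoint union of $K_2$ and $n-2$ isolated vertices by adding all edges between them. **Theorem 1.1.** Let $G$ be a graph with $m$ edges and no isolated vertices. (i) If $G$ is $\theta_{1,2,3}$-free and $m\ge 8$, then $\lambda(G)\le \frac{1+\sqrt{4m-3}}{2}$, with equality if and only if $m$ is odd and $G\cong S_{\frac{m+3}{2},2}$. (ii) If $G$ is $\theta_{1,2,4}$-free and $m\ge 22$, then $\lambda(G)\le \frac{1+\sqrt{4m-3}}{2}$, with equality if and only if $m$ is odd and $G\cong S_{\frac{m+3}{2},2}$. -/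

import Mathlib

/-- The `k`-th vertex (`0 ≤ k ≤ l i`) of the `i`-th path of a generalized theta graph with path
lengths `l`. The two end vertices common to all paths are `Sum.inl 0` and `Sum.inl 1`; the internal
vertices of the `i`-th path are `Sum.inr ⟨i, 0⟩, …, Sum.inr ⟨i, l i - 2⟩`. -/
def thetaVertex {t : ℕ} (l : Fin t → ℕ) (i : Fin t) (k : ℕ) :
    Fin 2 ⊕ (Σ i : Fin t, Fin (l i - 1)) :=
  if h : 0 < k ∧ k < l i then Sum.inr ⟨i, ⟨k - 1, by omega⟩⟩
  else if k = 0 then Sum.inl 0 else Sum.inl 1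

/-- The generalized theta graph: two distinct vertices connected by `t` internally disjoint paths
of lengths (numbers of edges) `l 0, …, l (t - 1)`. -/
def generalizedThetaGraph {t : ℕ} (l : Fin t → ℕ) :
    SimpleGraph (Fin 2 ⊕ (Σ i : Fin t, Fin (l i - 1))) :=
  SimpleGraph.fromEdgeSet
    {e | ∃ (i : Fin t) (k : ℕ), k < l i ∧ e = s(thetaVertex l i k, thetaVertex l i (k + 1))}

/-- The theta graph with three paths, of lengths `p`, `q` and `r`. -/
def thetaGraph (p q r : ℕ) :
    SimpleGraph (Fin 2 ⊕ (Σ i : Fin 3, Fin (![p, q, r] i - 1))) :=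
  generalizedThetaGraph ![p, q, r]

/-- The join of two graphs: their disjoint union together with all edges between them. -/
def graphJoin {V W : Type*} (G : SimpleGraph V) (H : SimpleGraph W) : SimpleGraph (V ⊕ W) :=
  (G ⊕g H) ⊔ completeBipartiteGraph V W

/-- The complete split graph `S_{n,k}`, the join of `K_k` with `n - k` isolated vertices
(for `k ≤ n`). -/
def completeSplitGraph (n k : ℕ) : SimpleGraph (Fin k ⊕ Fin (n - k)) :=
  graphJoin (⊤ : SimpleGraph (Fin k)) (⊥ : SimpleGraph (Fin (n - k)))

/-- The spectral radius of a finite graph: the largest modulus of an eigenvalue of its adjacency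
matrix. That matrix is real symmetric, so its eigenvalues are real and the real spectrum is the
whole spectrum; it is finite, so the supremum in `spectralRadius` is attained and finite (when
there is at least one vertex). -/
noncomputable def graphSpectralRadius {V : Type*} [Fintype V] [DecidableEq V]
    (G : SimpleGraph V) [DecidableRel G.Adj] : ℝ :=
  (spectralRadius ℝ (G.adjMatrix ℝ)).toReal

/-! Put `lam = λ(G)`. The bound says `lam ^ 2 - lam ≤ m - 1`. Take a nonnegative eigenvector `x`
with maximal entry `x u = 1`. Applying the eigenvalue equation twice at `u` and counting edges by
their position relative to `u` gives `spectral_count`: `lam ^ 2 - lam - (m - 1)` is `1` plus a sum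
of local gains over the neighbours of `u`, minus a nonnegative remainder. It remains to show that
the gains total at most `-1`.

The gains are summed over the components of the link of `u`. The forbidden theta graph is a five- or
six-cycle with a short chord, so the link has no path on four or five vertices respectively; its
components are then isolated vertices, double stars, triangles with leaves at one vertex, or four
vertices spanned by a four-cycle (`NoPathFive.classify`). Every component has negative gain, and a
double star has gain at most `-1`. If the bound is attained on a double star, `rigidity` shows that
there is no other component, no vertex beyond the neighbours of `u`, and that the double star is a
star: `G` is the complete split graph.

In the `θ_{1,2,4}` case, `m ≥ 22` gives `lam > 5`, and triangles and quadrilaterals gain less than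
`-1`. In the `θ_{1,2,3}` case, `m ≥ 8` gives only `lam > 3`, and a triangle is merely known to be
negative; links without double stars are excluded by the global count `count_lt_of_triangles`. -/

/-! ### The forbidden theta graphs as five- and six-cycles with a short chord. -/

theorem no_house_of_free {V : Type*} {G : SimpleGraph V} (hG : (thetaGraph 1 2 3).Free G)
    (a b c d e : V) (hab : G.Adj a b) (hbc : G.Adj b c) (hcd : G.Adj c d) (hde : G.Adj d e)
    (hea : G.Adj e a) (hac : G.Adj a c) (had : a ≠ d) (hbd : b ≠ d) (hbe : b ≠ e)
    (hce : c ≠ e) : False := by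
  apply hG
  have n1 := hab.ne; have n2 := hbc.ne; have n3 := hcd.ne; have n4 := hde.ne
  have n5 := hea.ne; have n6 := hac.ne
  -- The branch vertices are `a` and `c`; the paths are `a c`, `a b c` and `a e d c`.
  refine ⟨⟨⟨fun s => match s with
    | Sum.inl i => if i = 0 then a else c
    | Sum.inr ⟨i, k⟩ => if i = 1 then b else if k.val = 0 then e else d, ?_⟩, ?_⟩⟩
  · intro s t h
    rw [thetaGraph, generalizedThetaGraph, SimpleGraph.fromEdgeSet_adj] at h
    obtain ⟨⟨i, k, hk, hst⟩, -⟩ := h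
    fin_cases i <;> simp at hk <;> (first | subst hk | interval_cases k) <;>
      simp [thetaVertex] at hst <;> rcases hst with ⟨rfl, rfl⟩ | ⟨rfl, rfl⟩ <;>
      simp [*, G.adj_comm] <;> simp [*, hea.symm]
  · rintro (s | ⟨i, k, hk⟩) (t | ⟨j, l, hl⟩) h
    · fin_cases s <;> fin_cases t <;> simp_all
    · fin_cases s <;> fin_cases j <;> simp at hl <;> (first | subst hl | interval_cases l) <;> simp_all
    · fin_cases t <;> fin_cases i <;> simp at hk <;> (first | subst hk | interval_cases k) <;> simp_all
    · fin_cases i <;> fin_cases j <;> simp at hk hl <;> (first | subst hk | interval_cases k) <;>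
        (first | subst hl | interval_cases l) <;>
        simp_all

theorem no_hexagon_of_free {V : Type*} {G : SimpleGraph V} (hG : (thetaGraph 1 2 4).Free G)
    (a b c d e f : V) (hab : G.Adj a b) (hbc : G.Adj b c) (hcd : G.Adj c d) (hde : G.Adj d e)
    (hef : G.Adj e f) (hfa : G.Adj f a) (hac : G.Adj a c) (had : a ≠ d) (hae : a ≠ e)
    (hbd : b ≠ d) (hbe : b ≠ e) (hbf : b ≠ f) (hce : c ≠ e) (hcf : c ≠ f) (hdf : d ≠ f) :
    False := by
  apply hG
  have n1 := hab.ne; have n2 := hbc.ne; have n3 := hcd.ne; have n4 := hde.ne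
  have n5 := hef.ne; have n6 := hac.ne; have n7 := hfa.ne
  refine ⟨⟨⟨fun s => match s with
    | Sum.inl i => if i = 0 then a else c
    | Sum.inr ⟨i, k⟩ => if i = 1 then b else if k.val = 0 then f else if k.val = 1 then e else d,
    ?_⟩, ?_⟩⟩
  · intro s t h
    rw [thetaGraph, generalizedThetaGraph, SimpleGraph.fromEdgeSet_adj] at h
    obtain ⟨⟨i, k, hk, hst⟩, -⟩ := h
    fin_cases i <;> simp at hk <;> (first | subst hk | interval_cases k) <;>
      simp [thetaVertex] at hst <;> rcases hst with ⟨rfl, rfl⟩ | ⟨rfl, rfl⟩ <;>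
      simp [*, G.adj_comm] <;> simp [*, hfa.symm]
  · rintro (s | ⟨i, k, hk⟩) (t | ⟨j, l, hl⟩) h
    · fin_cases s <;> fin_cases t <;> simp_all
    · fin_cases s <;> fin_cases j <;> simp at hl <;> (first | subst hl | interval_cases l) <;> simp_all
    · fin_cases t <;> fin_cases i <;> simp at hk <;> (first | subst hk | interval_cases k) <;> simp_all
    · fin_cases i <;> fin_cases j <;> simp at hk hl <;> (first | subst hk | interval_cases k) <;>
        (first | subst hl | interval_cases l) <;>
        simp_all

/-! ### Components of graphs without a path on five vertices. -/

section PathFree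
variable {V : Type*} {H : SimpleGraph V}

/-- `H` has no path on five vertices as a subgraph. -/
def NoPathFive (H : SimpleGraph V) : Prop :=
  ∀ a b c d e : V, H.Adj a b → H.Adj b c → H.Adj c d → H.Adj d e →
    a ≠ c → a ≠ d → a ≠ e → b ≠ d → b ≠ e → c ≠ e → False

/-- `a b c d` is a four-cycle spanning a component. -/
structure IsQuadComponent (H : SimpleGraph V) (a b c d : V) : Prop where
  hab : H.Adj a b
  hbc : H.Adj b c
  hcd : H.Adj c d
  hda : H.Adj d a
  hac : a ≠ c
  hbd : b ≠ d
  closed : ∀ y z, (y = a ∨ y = b ∨ y = c ∨ y = d) → H.Adj y z → (z = a ∨ z = b ∨ z = c ∨ z = d)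

/-- A triangle `c p q` whose component has, besides it, only leaves attached to `c`. -/
structure IsTriangleComponent (H : SimpleGraph V) (c p q : V) : Prop where
  hcp : H.Adj c p
  hcq : H.Adj c q
  hpq : H.Adj p q
  adj_p : ∀ y, H.Adj p y → y = c ∨ y = q
  adj_q : ∀ y, H.Adj q y → y = c ∨ y = p
  leaf : ∀ y z, H.Adj c y → y ≠ p → y ≠ q → H.Adj y z → z = c

/-- An edge `c d` whose component has, besides it, only leaves attached to `c` or `d`. -/
structure IsTreeComponent (H : SimpleGraph V) (c d : V) : Prop where
  hcd : H.Adj c d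
  leaf_c : ∀ y z, H.Adj c y → y ≠ d → H.Adj y z → z = c
  leaf_d : ∀ y z, H.Adj d y → y ≠ c → H.Adj y z → z = d

theorem mem_of_reachable {p : V → Prop} (hp : ∀ y z, p y → H.Adj y z → p z) {v t : V}
    (h : H.Reachable v t) (ht : p t) : p v := by
  obtain ⟨w⟩ := h
  induction w with
  | nil => exact ht
  | cons hadj _ ih => exact hp _ _ (ih ht) hadj.symm

/-- An edge leaving the four-cycle, continued once around it, is a path on five vertices. -/
theorem NoPathFive.quad (h5 : NoPathFive H) {a b c d : V} (hab : H.Adj a b) (hbc : H.Adj b c)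
    (hcd : H.Adj c d) (hda : H.Adj d a) (hac : a ≠ c) (hbd : b ≠ d) :
    IsQuadComponent H a b c d := by
  refine ⟨hab, hbc, hcd, hda, hac, hbd, ?_⟩
  have n1 := hab.ne; have n2 := hbc.ne; have n3 := hcd.ne; have n4 := hda.ne
  intro y z hy hyz
  by_contra! hz
  obtain ⟨z1, z2, z3, z4⟩ := hz
  rcases hy with rfl | rfl | rfl | rfl
  · exact h5 z y b c d hyz.symm hab hbc hcd z2 z3 z4 hac n4.symm hbd
  · exact h5 z y c d a hyz.symm hbc hcd hda z3 z4 z1 hbd n1.symm hac.symm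
  · exact h5 z y d a b hyz.symm hcd hda hab z4 z1 z2 hac.symm n2.symm hbd.symm
  · exact h5 z y a b c hyz.symm hda hab hbc z1 z2 z3 hbd.symm n3.symm hac

theorem NoPathFive.triangle_aux (h5 : NoPathFive H) {a b c : V} (hab : H.Adj a b)
    (hbc : H.Adj b c) (hca : H.Adj c a)
    (ha : ∀ y, H.Adj a y → y = c ∨ y = b) (hb : ∀ y, H.Adj b y → y = c ∨ y = a) :
    IsTriangleComponent H c a b := by
  refine ⟨hca, hbc.symm, hab, ha, hb, ?_⟩
  intro y z hcy hya hyb hyz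
  by_contra hzc
  have hza : z ≠ a := by
    rintro rfl
    rcases ha y hyz.symm with h | h
    · exact hcy.ne h.symm
    · exact hyb h
  have hzb : z ≠ b := by
    rintro rfl
    rcases hb y hyz.symm with h | h
    · exact hcy.ne h.symm
    · exact hya h
  exact h5 z y c a b hyz.symm hcy.symm hca hab hzc hza hzb hya hyb hbc.ne.symm

/-- If at most one vertex of the triangle has neighbours outside it, that vertex is the centre.
Otherwise two such vertices have a common outside neighbour, since distinct ones would end a path on
five vertices. -/
theorem NoPathFive.triangle (h5 : NoPathFive H) {a b c : V} (hab : H.Adj a b) (hbc : H.Adj b c)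
    (hca : H.Adj c a) :
    (∃ x y z t, IsQuadComponent H x y z t ∧ (a = x ∨ a = y ∨ a = z ∨ a = t)) ∨
    ∃ x p q, IsTriangleComponent H x p q ∧ (a = x ∨ H.Adj x a) := by
  have n1 := hab.ne; have n2 := hbc.ne; have n3 := hca.ne
  -- two vertices of the triangle with outside neighbours give a four-cycle
  have key : ∀ a b c : V, H.Adj a b → H.Adj b c → H.Adj c a →
      (∃ y, H.Adj a y ∧ ¬ (y = c ∨ y = b)) → (∃ y, H.Adj b y ∧ ¬ (y = c ∨ y = a)) →
      ∃ y, IsQuadComponent H a y b c := by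
    rintro a b c hab hbc hca ⟨y, hy, hy'⟩ ⟨z, hz, hz'⟩
    push Not at hy' hz'
    have n1 := hab.ne; have n2 := hbc.ne; have n3 := hca.ne
    by_cases hyz : y = z
    · subst hyz
      exact ⟨y, h5.quad hy hz.symm hbc hca n1 hy'.1⟩
    · exact (h5 y a c b z hy.symm hca.symm hbc.symm hz hy'.1 hy'.2 hyz n1 hz'.2.symm
        hz'.1.symm).elim
  by_cases ha : ∃ y, H.Adj a y ∧ ¬ (y = c ∨ y = b)
  · by_cases hb : ∃ y, H.Adj b y ∧ ¬ (y = c ∨ y = a)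
    · obtain ⟨y, hy⟩ := key a b c hab hbc hca ha hb
      exact Or.inl ⟨_, _, _, _, hy, by simp⟩
    by_cases hc : ∃ y, H.Adj c y ∧ ¬ (y = b ∨ y = a)
    · obtain ⟨y, hy⟩ := key a c b hca.symm hbc.symm hab.symm
        (by obtain ⟨y, h1, h2⟩ := ha; exact ⟨y, h1, fun h => h2 h.symm⟩) hc
      exact Or.inl ⟨_, _, _, _, hy, by simp⟩
    · push Not at hb hc
      exact Or.inr ⟨a, b, c, h5.triangle_aux hbc hca hab
        (fun y hy => (hb y hy).symm) (fun y hy => (hc y hy).symm), by simp⟩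
  · by_cases hb : ∃ y, H.Adj b y ∧ ¬ (y = c ∨ y = a)
    · by_cases hc : ∃ y, H.Adj c y ∧ ¬ (y = b ∨ y = a)
      · obtain ⟨y, hy⟩ := key b c a hbc hca hab
          (by obtain ⟨y, h1, h2⟩ := hb; exact ⟨y, h1, fun h => h2 h.symm⟩)
          (by obtain ⟨y, h1, h2⟩ := hc; exact ⟨y, h1, fun h => h2 h.symm⟩)
        exact Or.inl ⟨_, _, _, _, hy, by simp⟩
      · push Not at ha hc
        exact Or.inr ⟨b, c, a, h5.triangle_aux hca hab hbc
          (fun y hy => (hc y hy)) (fun y hy => (ha y hy).symm), Or.inr hab.symm⟩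
    · push Not at ha hb
      exact Or.inr ⟨c, a, b, h5.triangle_aux hab hbc hca ha hb, Or.inr hca⟩

theorem IsTriangleComponent.closed {c p q : V} (h : IsTriangleComponent H c p q) (y z : V)
    (hy : y = c ∨ H.Adj c y) (hyz : H.Adj y z) : z = c ∨ H.Adj c z := by
  rcases hy with rfl | hy
  · exact Or.inr hyz
  · by_cases hp : y = p
    · subst hp
      rcases h.adj_p z hyz with rfl | rfl
      · exact Or.inl rfl
      · exact Or.inr h.hcq
    · by_cases hq : y = q
      · subst hq
        rcases h.adj_q z hyz with rfl | rfl
        · exact Or.inl rfl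
        · exact Or.inr h.hcp
      · exact Or.inl (h.leaf y z hy hp hq hyz)

theorem IsTreeComponent.closed {c d : V} (h : IsTreeComponent H c d) (y z : V)
    (hy : H.Adj c y ∨ H.Adj d y) (hyz : H.Adj y z) : H.Adj c z ∨ H.Adj d z := by
  rcases hy with hy | hy
  · by_cases hd : y = d
    · subst hd; exact Or.inr hyz
    · rw [h.leaf_c y z hy hd hyz]; exact Or.inr h.hcd.symm
  · by_cases hc : y = c
    · subst hc; exact Or.inl hyz
    · rw [h.leaf_d y z hy hc hyz]; exact Or.inl h.hcd

/-- Components of a graph without paths on five vertices. -/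
theorem NoPathFive.classify (h5 : NoPathFive H) (v : V) :
    (∀ w, ¬ H.Adj v w) ∨
    (∃ a b c d, IsQuadComponent H a b c d ∧ (v = a ∨ v = b ∨ v = c ∨ v = d)) ∨
    (∃ c p q, IsTriangleComponent H c p q ∧ (v = c ∨ H.Adj c v)) ∨
    ∃ c d, IsTreeComponent H c d ∧ (H.Adj c v ∨ H.Adj d v) := by
  by_cases hiso : ∀ w, ¬ H.Adj v w
  · exact Or.inl hiso
  right
  push Not at hiso
  obtain ⟨w, hvw⟩ := hiso
  by_cases hquad : ∃ a b c d, IsQuadComponent H a b c d ∧ H.Reachable v a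
  · obtain ⟨a, b, c, d, h, hr⟩ := hquad
    exact Or.inl ⟨a, b, c, d, h, mem_of_reachable h.closed hr (by simp)⟩
  right
  by_cases htri : ∃ c p q, IsTriangleComponent H c p q ∧ H.Reachable v c
  · obtain ⟨c, p, q, h, hr⟩ := htri
    exact Or.inl ⟨c, p, q, h, mem_of_reachable h.closed hr (by simp)⟩
  right
  push Not at hquad htri
  have no4 : ∀ a b c d, H.Reachable v a → H.Adj a b → H.Adj b c → H.Adj c d → H.Adj d a →
      a ≠ c → b ≠ d → False := fun a b c d hr h1 h2 h3 h4 h6 h7 =>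
    hquad a b c d (h5.quad h1 h2 h3 h4 h6 h7) hr
  have no3 : ∀ a b c, H.Reachable v a → H.Adj a b → H.Adj b c → H.Adj c a → False := by
    intro a b c hr h1 h2 h3
    rcases h5.triangle h1 h2 h3 with ⟨x, y, z, t, hq, hm⟩ | ⟨x, p, q, ht, hm⟩
    · have key : H.Reachable a x := by
        rcases hm with rfl | rfl | rfl | rfl
        · exact SimpleGraph.Reachable.refl _
        · exact hq.hab.symm.reachable
        · exact (hq.hcd.reachable.trans hq.hda.reachable)
        · exact hq.hda.reachable
      exact hquad x y z t hq (hr.trans key)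
    · have key : H.Reachable a x := by
        rcases hm with rfl | hm
        · exact SimpleGraph.Reachable.refl _
        · exact hm.symm.reachable
      exact htri x p q ht (hr.trans key)
  -- The component now has no triangle or four-cycle. The middle edge `c d` of a path on four
  -- vertices carries only leaves: going one step further would give a path on five vertices or one
  -- of these cycles.
  by_cases hP : ∃ a c d b, H.Reachable v c ∧ H.Adj a c ∧ H.Adj c d ∧ H.Adj d b ∧ a ≠ d ∧ c ≠ b
  · obtain ⟨a, c, d, b, hr, hac, hcd, hdb, had, hcb⟩ := hP
    have hab : a ≠ b := by
      rintro rfl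
      exact no3 c d a hr hcd hdb hac
    have hrd := hr.trans hcd.reachable
    have ht : IsTreeComponent H c d := by
      refine ⟨hcd, ?_, ?_⟩
      · intro y z hy hyd hyz
        by_contra hz
        have hzd : z ≠ d := by
          rintro rfl
          exact no3 c y z hr hy hyz hcd.symm
        have hyb : y ≠ b := by
          rintro rfl
          exact no3 c d y hr hcd hdb hy.symm
        have hzb : z ≠ b := by
          rintro rfl
          exact no4 c y z d hr hy hyz hdb.symm hcd.symm hcb hyd
        exact h5 z y c d b hyz.symm hy.symm hcd hdb hz hzd hzb hyd hyb hcb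
      · intro y z hy hyc hyz
        by_contra hz
        have hzc : z ≠ c := by
          rintro rfl
          exact no3 d y z hrd hy hyz hcd
        have hya : y ≠ a := by
          rintro rfl
          exact no3 c d y hr hcd hy hac
        have hza : z ≠ a := by
          rintro rfl
          exact no4 d y z c hrd hy hyz hac hcd had.symm hyc
        exact h5 z y d c a hyz.symm hy.symm hcd.symm hac.symm hz hzc hza hyc hya had.symm
    exact ⟨c, d, ht, mem_of_reachable ht.closed hr (Or.inr hcd.symm)⟩
  · push Not at hP
    have hrw := hvw.reachable
    -- Without a path on four vertices the component is a star, centred at `w` if `w` has a second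
    -- neighbour and at `v` otherwise.
    by_cases hw : ∃ y, H.Adj w y ∧ y ≠ v
    · obtain ⟨y, hwy, hyv⟩ := hw
      refine ⟨w, v, ⟨hvw.symm, ?_, ?_⟩, Or.inl hvw.symm⟩
      · intro y z hy hyv hyz
        have := hP z y w v (hrw.trans hy.reachable) hyz.symm hy.symm hvw.symm
        by_contra hz
        exact hyv (this hz)
      · intro z t hz hzw hzt
        exact (hyv (hP z v w y (SimpleGraph.Reachable.refl _) hz.symm hvw hwy hzw).symm).elim
    · push Not at hw
      refine ⟨v, w, ⟨hvw, ?_, ?_⟩, Or.inr hvw.symm⟩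
      · intro y z hy hyw hyz
        by_contra hz
        exact hyw (hP z y v w hy.reachable hyz.symm hy.symm hvw hz)
      · intro y z hy hyv hyz
        exact (hyv (hw y hy)).elim
end PathFree

/-! ### The spectral radius and a nonnegative eigenvector. -/

section Spectral
variable {V : Type*} [Fintype V] [DecidableEq V] (G : SimpleGraph V) [DecidableRel G.Adj]

omit [Fintype V] [DecidableEq V] in
theorem isHermitian_adjMatrix : (G.adjMatrix ℝ).IsHermitian := by
  rw [Matrix.IsHermitian, Matrix.conjTranspose_eq_transpose_of_trivial]
  exact SimpleGraph.transpose_adjMatrix G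

theorem exists_graphSpectralRadius [Nonempty V] :
    ∃ k ∈ spectrum ℝ (G.adjMatrix ℝ), graphSpectralRadius G = |k| ∧
      ∀ l ∈ spectrum ℝ (G.adjMatrix ℝ), |l| ≤ |k| := by
  have hs := (isHermitian_adjMatrix G).spectrum_real_eq_range_eigenvalues
  obtain ⟨i, -, hi⟩ := Finset.exists_max_image Finset.univ
    (fun i => |(isHermitian_adjMatrix G).eigenvalues i|) Finset.univ_nonempty
  have hmax : ∀ l ∈ spectrum ℝ (G.adjMatrix ℝ),
      |l| ≤ |(isHermitian_adjMatrix G).eigenvalues i| := by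
    intro l hl
    rw [hs] at hl
    obtain ⟨j, rfl⟩ := hl
    exact hi j (Finset.mem_univ _)
  have hmem : (isHermitian_adjMatrix G).eigenvalues i ∈ spectrum ℝ (G.adjMatrix ℝ) := by
    rw [hs]; exact ⟨i, rfl⟩
  refine ⟨_, hmem, ?_, hmax⟩
  have : spectralRadius ℝ (G.adjMatrix ℝ) = ‖(isHermitian_adjMatrix G).eigenvalues i‖₊ := by
    apply le_antisymm
    · refine iSup₂_le fun l hl => ?_
      exact_mod_cast hmax l hl
    · exact le_iSup₂ (f := fun k (_ : k ∈ spectrum ℝ (G.adjMatrix ℝ)) => (‖k‖₊ : ENNReal)) _ hmem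
  rw [graphSpectralRadius, this]
  simp

theorem mem_spectrum_iff_exists_eigenvector (k : ℝ) :
    k ∈ spectrum ℝ (G.adjMatrix ℝ) ↔ ∃ y : V → ℝ, y ≠ 0 ∧ (G.adjMatrix ℝ).mulVec y = k • y := by
  rw [← Matrix.spectrum_toLin', ← Module.End.hasEigenvalue_iff_mem_spectrum]
  constructor
  · intro h
    obtain ⟨y, hy⟩ := h.exists_hasEigenvector
    exact ⟨y, hy.2, by simpa using hy.apply_eq_smul⟩
  · rintro ⟨y, hy0, hy⟩
    exact Module.End.hasEigenvalue_of_hasEigenvector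
      (Module.End.hasEigenvector_iff.2 ⟨Module.End.mem_eigenspace_iff.2 (by simpa using hy), hy0⟩)

theorem le_graphSpectralRadius [Nonempty V] (k : ℝ) (y : V → ℝ) (hy : y ≠ 0)
    (h : ∀ v, ∑ w ∈ G.neighborFinset v, y w = k * y v) : k ≤ graphSpectralRadius G := by
  obtain ⟨l, -, hl, hmax⟩ := exists_graphSpectralRadius G
  rw [hl]
  refine (le_abs_self k).trans (hmax k ?_)
  rw [mem_spectrum_iff_exists_eigenvector]
  refine ⟨y, hy, ?_⟩
  ext v
  rw [SimpleGraph.adjMatrix_mulVec_apply, h v]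
  rfl

/-- Connectedness plays no role. For an eigenvector `y` of an eigenvalue `k` of largest modulus, `x
= |y|` satisfies `A x ≥ |k| x` entrywise. Since `|k| - A` is positive semidefinite, its quadratic
form vanishes at `x`, and so `x` lies in its kernel. -/
theorem exists_nonneg_eigenvector [Nonempty V] :
    0 ≤ graphSpectralRadius G ∧ ∃ x : V → ℝ, (∀ v, 0 ≤ x v) ∧ x ≠ 0 ∧
      ∀ v, ∑ w ∈ G.neighborFinset v, x w = graphSpectralRadius G * x v := by
  obtain ⟨k, hk, hr, hmax⟩ := exists_graphSpectralRadius G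
  rw [hr]
  obtain ⟨y, hy0, hy⟩ := (mem_spectrum_iff_exists_eigenvector G k).1 hk
  set A := G.adjMatrix ℝ with hA
  have hpsd : (algebraMap ℝ (Matrix V V ℝ) |k| - A).PosSemidef := by
    rw [Matrix.posSemidef_iff_isHermitian_and_spectrum_nonneg]
    refine ⟨?_, ?_⟩
    · refine Matrix.IsHermitian.sub ?_ (isHermitian_adjMatrix G)
      rw [Matrix.IsHermitian, Matrix.algebraMap_eq_diagonal]
      simp
    · rw [← spectrum.singleton_sub_eq]
      rintro _ ⟨a, ha, l, hl, rfl⟩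
      rw [Set.mem_singleton_iff] at ha
      subst ha
      have := hmax l hl
      simp only [Set.mem_ofPred_eq]
      linarith [le_abs_self l]
  set x : V → ℝ := fun v => |y v| with hx
  have hge : ∀ v, |k| * x v ≤ A.mulVec x v := by
    intro v
    have h1 := congrFun hy v
    rw [SimpleGraph.adjMatrix_mulVec_apply] at h1 ⊢
    simp only [Pi.smul_apply, smul_eq_mul] at h1
    rw [hx, ← abs_mul, ← h1]
    exact Finset.abs_sum_le_sum_abs _ _
  have hmv : ∀ v, (algebraMap ℝ (Matrix V V ℝ) |k| - A).mulVec x v = |k| * x v - A.mulVec x v := by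
    intro v
    rw [Matrix.sub_mulVec, Pi.sub_apply, Algebra.algebraMap_eq_smul_one, Matrix.smul_mulVec]
    simp
  have hle : star x ⬝ᵥ (algebraMap ℝ (Matrix V V ℝ) |k| - A).mulVec x ≤ 0 := by
    refine Finset.sum_nonpos fun v _ => ?_
    rw [hmv]
    exact mul_nonpos_of_nonneg_of_nonpos (by simp [hx]) (by linarith [hge v])
  have hz := (hpsd.dotProduct_mulVec_zero_iff x).1
    (le_antisymm hle (hpsd.dotProduct_mulVec_nonneg x))
  refine ⟨abs_nonneg _, x, fun v => abs_nonneg _, ?_, ?_⟩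
  · intro h
    apply hy0
    ext v
    simpa [hx] using congrFun h v
  · intro v
    have := congrFun hz v
    rw [hmv, SimpleGraph.adjMatrix_mulVec_apply] at this
    simp only [Pi.zero_apply] at this
    linarith
end Spectral

/-! ### The spectral count around a vertex of maximal weight. -/

section LocalStructure
variable {V : Type*} [Fintype V] [DecidableEq V] (G : SimpleGraph V) [DecidableRel G.Adj]

/-- The graph induced on the neighbourhood of `u`, all other vertices being isolated. -/
def linkGraph {V : Type*} (G : SimpleGraph V) (u : V) : SimpleGraph V where
  Adj v w := G.Adj v w ∧ G.Adj u v ∧ G.Adj u w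
  symm := ⟨fun _ _ h => ⟨h.1.symm, h.2.2, h.2.1⟩⟩
  loopless := ⟨fun _ h => h.1.ne rfl⟩

/-- The vertices other than `u` that are not adjacent to `u`. -/
def outer (u : V) : Finset V := Finset.univ.filter fun w => w ≠ u ∧ ¬ G.Adj u w

/-- The common neighbours of `u` and `v`. -/
def inNbrs (u v : V) : Finset V := (G.neighborFinset v).filter fun w => G.Adj u w

/-- The neighbours of `v` that are neither `u` nor adjacent to `u`. -/
def outNbrs (u v : V) : Finset V := (G.neighborFinset v).filter fun w => w ≠ u ∧ ¬ G.Adj u w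

variable {G}

theorem mem_outer {u w : V} : w ∈ outer G u ↔ w ≠ u ∧ ¬ G.Adj u w := by simp [outer]

omit [DecidableEq V] in
theorem mem_inNbrs {u v w : V} : w ∈ inNbrs G u v ↔ G.Adj v w ∧ G.Adj u w := by simp [inNbrs]

theorem mem_outNbrs {u v w : V} : w ∈ outNbrs G u v ↔ G.Adj v w ∧ w ≠ u ∧ ¬ G.Adj u w := by
  simp [outNbrs]

theorem sum_neighborFinset_of_adj {u v : V} (h : G.Adj u v) (g : V → ℝ) :
    ∑ w ∈ G.neighborFinset v, g w
      = g u + ∑ w ∈ inNbrs G u v, g w + ∑ w ∈ outNbrs G u v, g w := by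
  have h1 : G.neighborFinset v = insert u (inNbrs G u v ∪ outNbrs G u v) := by
    ext w
    simp only [SimpleGraph.mem_neighborFinset, Finset.mem_insert, Finset.mem_union, mem_inNbrs,
      mem_outNbrs]
    have := h.symm
    by_cases hw : w = u
    · subst hw; simpa
    · simp only [hw, ne_eq, not_false_eq_true, true_and, false_or]; tauto
  rw [h1, Finset.sum_insert, Finset.sum_union, add_assoc]
  · exact Finset.disjoint_left.2 fun w h1 h2 => (mem_outNbrs.1 h2).2.2 (mem_inNbrs.1 h1).2
  · simp [mem_inNbrs, mem_outNbrs]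

theorem sum_neighborFinset_of_mem_outer {u v : V} (h : v ∈ outer G u) (g : V → ℝ) :
    ∑ w ∈ G.neighborFinset v, g w
      = ∑ w ∈ inNbrs G u v, g w + ∑ w ∈ outNbrs G u v, g w := by
  rw [mem_outer] at h
  have h1 : G.neighborFinset v = inNbrs G u v ∪ outNbrs G u v := by
    ext w
    simp only [SimpleGraph.mem_neighborFinset, Finset.mem_union, mem_inNbrs, mem_outNbrs]
    by_cases hw : w = u
    · subst hw
      simp only [SimpleGraph.irrefl, and_false, ne_eq, not_true_eq_false, false_and, or_self,
        iff_false]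
      exact fun h' => h.2 h'.symm
    · simp only [hw, ne_eq, not_false_eq_true, true_and]; tauto
  rw [h1, Finset.sum_union]
  exact Finset.disjoint_left.2 fun w h1 h2 => (mem_outNbrs.1 h2).2.2 (mem_inNbrs.1 h1).2

theorem sum_univ_eq_outer (u : V) (g : V → ℝ) :
    ∑ v, g v = g u + ∑ v ∈ G.neighborFinset u, g v + ∑ w ∈ outer G u, g w := by
  have h1 : (Finset.univ : Finset V) = insert u (G.neighborFinset u ∪ outer G u) := by
    ext w
    simp only [Finset.mem_univ, SimpleGraph.mem_neighborFinset, Finset.mem_insert,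
      Finset.mem_union, mem_outer, true_iff]
    tauto
  rw [h1, Finset.sum_insert, Finset.sum_union, add_assoc]
  · exact Finset.disjoint_left.2 fun w h1 h2 => (mem_outer.1 h2).2 (by simpa using h1)
  · simp [mem_outer]

theorem sum_outNbrs_comm (u : V) (g : V → V → ℝ) :
    ∑ v ∈ G.neighborFinset u, ∑ w ∈ outNbrs G u v, g v w
      = ∑ w ∈ outer G u, ∑ v ∈ inNbrs G u w, g v w := by
  refine Finset.sum_comm' fun v w => ?_
  simp only [SimpleGraph.mem_neighborFinset, mem_outNbrs, mem_outer, mem_inNbrs, G.adj_comm w v]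
  tauto

omit [DecidableEq V] in
theorem sum_inNbrs_comm (u : V) (g : V → ℝ) :
    ∑ v ∈ G.neighborFinset u, ∑ w ∈ inNbrs G u v, g w
      = ∑ v ∈ G.neighborFinset u, ((inNbrs G u v).card : ℝ) * g v := by
  rw [Finset.sum_comm' (t' := G.neighborFinset u) (s' := fun w => inNbrs G u w)]
  · simp
  · intro v w
    simp only [SimpleGraph.mem_neighborFinset, mem_inNbrs, G.adj_comm w v]
    tauto

/-- A nonnegative eigenvector whose largest entry is `x u = 1`. -/
structure IsPerronVector (G : SimpleGraph V) [DecidableRel G.Adj] (lam : ℝ) (u : V) (x : V → ℝ) :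
    Prop where
  nonneg : ∀ v, 0 ≤ x v
  le_one : ∀ v, x v ≤ 1
  apply_self : x u = 1
  eig : ∀ v, ∑ w ∈ G.neighborFinset v, x w = lam * x v

theorem exists_isPerronVector [Nonempty V] :
    0 ≤ graphSpectralRadius G ∧ ∃ u x, IsPerronVector G (graphSpectralRadius G) u x := by
  obtain ⟨h0, x, hx, hx0, he⟩ := exists_nonneg_eigenvector G
  obtain ⟨u, -, hu⟩ := Finset.exists_max_image Finset.univ x Finset.univ_nonempty
  have hpos : 0 < x u := by
    obtain ⟨v, hv⟩ := Function.ne_iff.1 hx0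
    exact lt_of_lt_of_le (lt_of_le_of_ne (hx v) (Ne.symm hv)) (hu v (Finset.mem_univ v))
  refine ⟨h0, u, fun v => x v / x u, ?_, ?_, ?_, ?_⟩
  · exact fun v => div_nonneg (hx v) hpos.le
  · exact fun v => (div_le_one hpos).2 (hu v (Finset.mem_univ v))
  · exact div_self hpos.ne'
  · intro v
    rw [← Finset.sum_div, he v, mul_div_assoc]

/-- The share of an edge to an outer vertex `w` in the loss of the spectral count. -/
noncomputable def outerLoss (G : SimpleGraph V) [DecidableRel G.Adj] (u : V) (x : V → ℝ) (w : V) :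
    ℝ :=
  1 - x w + ((outNbrs G u w).card : ℝ) / (2 * (inNbrs G u w).card)

/-- The contribution of a neighbour `v` of `u` to the spectral count. -/
noncomputable def gain (G : SimpleGraph V) [DecidableRel G.Adj] (u : V) (x : V → ℝ) (v : V) : ℝ :=
  (((inNbrs G u v).card : ℝ) - 1) * x v - ((inNbrs G u v).card : ℝ) / 2
    - ∑ w ∈ outNbrs G u v, outerLoss G u x w

namespace IsPerronVector

variable {lam : ℝ} {u : V} {x : V → ℝ} (hx : IsPerronVector G lam u x)
include hx

omit [DecidableEq V] in
theorem sum_nbrs : ∑ v ∈ G.neighborFinset u, x v = lam := by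
  rw [hx.eig, hx.apply_self, mul_one]

theorem eig_nbr {v : V} (h : G.Adj u v) :
    lam * x v = 1 + ∑ w ∈ inNbrs G u v, x w + ∑ w ∈ outNbrs G u v, x w := by
  rw [← hx.eig, sum_neighborFinset_of_adj h, hx.apply_self]

theorem eig_outer {v : V} (h : v ∈ outer G u) :
    lam * x v = ∑ w ∈ inNbrs G u v, x w + ∑ w ∈ outNbrs G u v, x w := by
  rw [← hx.eig, sum_neighborFinset_of_mem_outer h]

omit [DecidableEq V] in
theorem sum_le_card (s : Finset V) : ∑ w ∈ s, x w ≤ s.card := by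
  simpa using Finset.sum_le_card_nsmul s x 1 fun w _ => hx.le_one w

omit [DecidableEq V] in
theorem sum_nonneg (s : Finset V) : 0 ≤ ∑ w ∈ s, x w :=
  Finset.sum_nonneg fun w _ => hx.nonneg w

theorem outerLoss_nonneg (w : V) : 0 ≤ outerLoss G u x w := by
  have := hx.le_one w
  have h2 : 0 ≤ ((outNbrs G u w).card : ℝ) / (2 * (inNbrs G u w).card) := by positivity
  unfold outerLoss
  linarith

theorem lam_mul_le {w : V} (h : w ∈ outer G u) :
    lam * x w ≤ (inNbrs G u w).card + (outNbrs G u w).card := by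
  rw [hx.eig_outer h]
  exact add_le_add (hx.sum_le_card _) (hx.sum_le_card _)

theorem pos_of_adj {v : V} (h : G.Adj u v) : 0 < x v := by
  have h1 := hx.eig_nbr h
  have h2 := hx.sum_nonneg (inNbrs G u v)
  have h3 := hx.sum_nonneg (outNbrs G u v)
  by_contra hc
  have : x v = 0 := le_antisymm (not_lt.1 hc) (hx.nonneg v)
  rw [this] at h1
  linarith

omit hx in
theorem two_mul_card_edgeFinset (G : SimpleGraph V) [DecidableRel G.Adj] (u : V) :
    2 * (G.edgeFinset.card : ℝ) = 2 * (G.neighborFinset u).card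
      + ∑ v ∈ G.neighborFinset u, ((inNbrs G u v).card : ℝ)
      + 2 * ∑ v ∈ G.neighborFinset u, ((outNbrs G u v).card : ℝ)
      + ∑ w ∈ outer G u, ((outNbrs G u w).card : ℝ) := by
  have h1 : (∑ v, (G.degree v : ℝ)) = 2 * (G.edgeFinset.card : ℝ) := by
    exact_mod_cast G.sum_degrees_eq_twice_card_edges
  have h2 : ∀ v, (G.degree v : ℝ) = ∑ w ∈ G.neighborFinset v, (1 : ℝ) := by
    intro v; simp
  have h3 := sum_outNbrs_comm (G := G) u (fun _ _ => 1)
  rw [← h1, sum_univ_eq_outer (G := G) u]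
  rw [Finset.sum_congr rfl fun v hv => (h2 v).trans
      (sum_neighborFinset_of_adj ((G.mem_neighborFinset u v).1 hv) _),
    Finset.sum_congr (s₁ := outer G u) rfl fun v hv => (h2 v).trans
      (sum_neighborFinset_of_mem_outer hv _)]
  simp only [Finset.sum_const, nsmul_eq_mul, mul_one, Finset.sum_add_distrib] at h3 ⊢
  rw [← h3, G.card_neighborFinset_eq_degree]
  ring

/-- Write `lam ^ 2` as the sum of `lam * x v` over the neighbours `v` of `u`, expand each term by
the eigenvalue equation at `v`, and compare with the degree sum. -/
theorem sq_sub_eq :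
    lam ^ 2 - lam - (G.edgeFinset.card - 1) = 1
      + ∑ v ∈ G.neighborFinset u, ((inNbrs G u v).card : ℝ) * x v - lam
      - (∑ v ∈ G.neighborFinset u, ((inNbrs G u v).card : ℝ)) / 2
      - ∑ v ∈ G.neighborFinset u, ((outNbrs G u v).card : ℝ)
      + ∑ v ∈ G.neighborFinset u, ∑ w ∈ outNbrs G u v, x w
      - (∑ w ∈ outer G u, ((outNbrs G u w).card : ℝ)) / 2 := by
  have h1 : lam ^ 2 = (G.neighborFinset u).card
      + ∑ v ∈ G.neighborFinset u, ((inNbrs G u v).card : ℝ) * x v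
      + ∑ v ∈ G.neighborFinset u, ∑ w ∈ outNbrs G u v, x w := by
    have : lam ^ 2 = ∑ v ∈ G.neighborFinset u, lam * x v := by
      rw [← Finset.mul_sum, hx.sum_nbrs, sq]
    rw [this, Finset.sum_congr rfl fun v hv => hx.eig_nbr ((G.mem_neighborFinset u v).1 hv),
      Finset.sum_add_distrib, Finset.sum_add_distrib, sum_inNbrs_comm]
    simp
  linarith [two_mul_card_edgeFinset G u]

/-- The spectral count: `lam ^ 2 - lam` compared with the number of edges. -/
theorem spectral_count :
    lam ^ 2 - lam - (G.edgeFinset.card - 1) = 1 + ∑ v ∈ G.neighborFinset u, gain G u x v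
      - ∑ w ∈ (outer G u).filter (fun w => inNbrs G u w = ∅),
        ((outNbrs G u w).card : ℝ) / 2 := by
  -- Half the outer degree of `w` is shared equally among its neighbours in the link; outer vertices
  -- with no such neighbour form the remainder.
  have h3 : ∑ v ∈ G.neighborFinset u, ∑ w ∈ outNbrs G u v,
      ((outNbrs G u w).card : ℝ) / (2 * (inNbrs G u w).card)
      + ∑ w ∈ (outer G u).filter (fun w => inNbrs G u w = ∅), ((outNbrs G u w).card : ℝ) / 2
      = ∑ w ∈ outer G u, ((outNbrs G u w).card : ℝ) / 2 := by
    rw [sum_outNbrs_comm u (fun _ w => ((outNbrs G u w).card : ℝ) / (2 * (inNbrs G u w).card)),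
      Finset.sum_filter, ← Finset.sum_add_distrib]
    refine Finset.sum_congr rfl fun w _ => ?_
    by_cases h : inNbrs G u w = ∅
    · simp [h]
    · have : ((inNbrs G u w).card : ℝ) ≠ 0 := by
        simpa [Finset.card_eq_zero] using h
      simp only [Finset.sum_const, nsmul_eq_mul, h, if_false]
      field_simp
      ring
  rw [← Finset.sum_div] at h3
  have h4 : ∑ v ∈ G.neighborFinset u, gain G u x v
      = ∑ v ∈ G.neighborFinset u, ((inNbrs G u v).card : ℝ) * x v - lam
        - (∑ v ∈ G.neighborFinset u, ((inNbrs G u v).card : ℝ)) / 2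
        - ∑ v ∈ G.neighborFinset u, ((outNbrs G u v).card : ℝ)
        + ∑ v ∈ G.neighborFinset u, ∑ w ∈ outNbrs G u v, x w
        - ∑ v ∈ G.neighborFinset u, ∑ w ∈ outNbrs G u v,
          ((outNbrs G u w).card : ℝ) / (2 * (inNbrs G u w).card) := by
    rw [← hx.sum_nbrs, Finset.sum_div]
    simp only [← Finset.sum_sub_distrib, ← Finset.sum_add_distrib]
    refine Finset.sum_congr rfl fun v _ => ?_
    simp only [gain, outerLoss, Finset.sum_add_distrib, Finset.sum_sub_distrib, Finset.sum_const,
      nsmul_eq_mul]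
    ring
  rw [h4, hx.sq_sub_eq]
  simp only [← Finset.sum_div] at h3 ⊢
  linarith

end IsPerronVector
end LocalStructure

/-! ### Gains summed over components of the link, and rigidity. -/

section Components
variable {V : Type*} [Fintype V] [DecidableEq V] {G : SimpleGraph V} [DecidableRel G.Adj]

/-- A set of neighbours of `u` that is a connected component of the link graph. -/
structure IsLinkComponent {V : Type*} (G : SimpleGraph V) (u : V) (T : Finset V) : Prop where
  subset : ∀ y ∈ T, G.Adj u y
  closed : ∀ y z, y ∈ T → (linkGraph G u).Adj y z → z ∈ T
  connected : ∃ c, ∀ y ∈ T, (linkGraph G u).Reachable c y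

omit [Fintype V] [DecidableEq V] [DecidableRel G.Adj] in
theorem IsLinkComponent.subset_of_closed {u v : V} {T S : Finset V} (hT : IsLinkComponent G u T)
    (hS : ∀ y z, y ∈ S → (linkGraph G u).Adj y z → z ∈ S) (hvT : v ∈ T) (hvS : v ∈ S) :
    T ⊆ S := by
  obtain ⟨c, hc⟩ := hT.connected
  intro y hy
  exact mem_of_reachable (p := (· ∈ S)) hS ((hc y hy).symm.trans (hc v hvT)) hvS

omit [Fintype V] [DecidableRel G.Adj] in
/-- If every component has negative sum, so has every nonempty union of components. -/
theorem sum_neg_of_components {u : V} {g : V → ℝ}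
    (h : ∀ v, G.Adj u v → ∃ T, IsLinkComponent G u T ∧ v ∈ T ∧ ∑ y ∈ T, g y < 0)
    (S : Finset V) (hSu : ∀ y ∈ S, G.Adj u y)
    (hS : ∀ y z, y ∈ S → (linkGraph G u).Adj y z → z ∈ S) (hne : S.Nonempty) :
    ∑ y ∈ S, g y < 0 := by
  induction S using Finset.strongInduction with
  | H S ih =>
    obtain ⟨v, hv⟩ := hne
    obtain ⟨T, hT, hvT, hneg⟩ := h v (hSu v hv)
    have hTS := hT.subset_of_closed hS hvT hv
    rw [← Finset.sum_sdiff hTS]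
    rcases (S \ T).eq_empty_or_nonempty with h0 | hne'
    · rw [h0]; simpa using hneg
    · have := ih (S \ T) (Finset.sdiff_ssubset hTS ⟨v, hvT⟩)
        (fun y hy => hSu y (Finset.mem_sdiff.1 hy).1) (fun y z hy hyz => by
          rw [Finset.mem_sdiff] at hy ⊢
          exact ⟨hS y z hy.1 hyz, fun hz => hy.2 (hT.closed z y hz hyz.symm)⟩) hne'
      linarith

/-- The other components can only lower the total, strictly so if there are any. -/
theorem sum_le_of_component {u : V} {g : V → ℝ}
    (h : ∀ v, G.Adj u v → ∃ T, IsLinkComponent G u T ∧ v ∈ T ∧ ∑ y ∈ T, g y < 0)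
    {T : Finset V} (hT : IsLinkComponent G u T) :
    ∑ y ∈ G.neighborFinset u, g y ≤ ∑ y ∈ T, g y ∧
      (∑ y ∈ T, g y ≤ ∑ y ∈ G.neighborFinset u, g y → T = G.neighborFinset u) := by
  have hTS : T ⊆ G.neighborFinset u := fun y hy => by simpa using hT.subset y hy
  rcases (G.neighborFinset u \ T).eq_empty_or_nonempty with h0 | hne
  · have : T = G.neighborFinset u := hTS.antisymm (Finset.sdiff_eq_empty_iff_subset.1 h0)
    rw [this]
    simp
  · have := sum_neg_of_components h (G.neighborFinset u \ T) (by simp +contextual)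
      (fun y z hy hyz => by
        rw [Finset.mem_sdiff] at hy ⊢
        exact ⟨by simpa using hyz.2.2, fun hz => hy.2 (hT.closed z y hz hyz.symm)⟩) hne
    rw [← Finset.sum_sdiff hTS]
    exact ⟨by linarith, fun h => by linarith⟩

omit [DecidableEq V] in
theorem linkGraph_adj {u v w : V} (hv : G.Adj u v) :
    (linkGraph G u).Adj v w ↔ w ∈ inNbrs G u v := by
  rw [mem_inNbrs]
  exact ⟨fun h => ⟨h.1, h.2.2⟩, fun h => ⟨h.1, hv, h.2⟩⟩

omit [Fintype V] [DecidableEq V] [DecidableRel G.Adj] in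
theorem isLinkComponent_singleton {u v : V} (hv : G.Adj u v)
    (h : ∀ w, ¬ (linkGraph G u).Adj v w) : IsLinkComponent G u {v} := by
  refine ⟨by simpa using hv, ?_, v, by simp⟩
  intro y z hy hyz
  rw [Finset.mem_singleton] at hy
  subst hy
  exact (h z hyz).elim

theorem IsTreeComponent.isLinkComponent {u c d : V} (h : IsTreeComponent (linkGraph G u) c d) :
    IsLinkComponent G u (inNbrs G u c ∪ inNbrs G u d) := by
  have hc := h.hcd.2.1
  have hd := h.hcd.2.2
  have hm : ∀ y, y ∈ inNbrs G u c ∪ inNbrs G u d ↔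
      (linkGraph G u).Adj c y ∨ (linkGraph G u).Adj d y := by
    intro y
    rw [Finset.mem_union, linkGraph_adj hc, linkGraph_adj hd]
  refine ⟨fun y hy => ?_, fun y z hy hyz => ?_, c, fun y hy => ?_⟩
  · rcases (hm y).1 hy with h' | h' <;> exact h'.2.2
  · rw [hm] at hy ⊢
    exact h.closed y z hy hyz
  · rcases (hm y).1 hy with h' | h'
    · exact h'.reachable
    · exact h.hcd.reachable.trans h'.reachable

theorem IsTriangleComponent.isLinkComponent {u c p q : V}
    (h : IsTriangleComponent (linkGraph G u) c p q) :
    IsLinkComponent G u (insert c (inNbrs G u c)) := by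
  have hc := h.hcp.2.1
  have hm : ∀ y, y ∈ insert c (inNbrs G u c) ↔ y = c ∨ (linkGraph G u).Adj c y := by
    intro y
    rw [Finset.mem_insert, linkGraph_adj hc]
  refine ⟨fun y hy => ?_, fun y z hy hyz => ?_, c, fun y hy => ?_⟩
  · rcases (hm y).1 hy with rfl | h'
    · exact hc
    · exact h'.2.2
  · rw [hm] at hy ⊢
    exact h.closed y z hy hyz
  · rcases (hm y).1 hy with rfl | h'
    · exact SimpleGraph.Reachable.refl _
    · exact h'.reachable

omit [Fintype V] [DecidableRel G.Adj] in
theorem IsQuadComponent.isLinkComponent {u a b c d : V}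
    (h : IsQuadComponent (linkGraph G u) a b c d) :
    IsLinkComponent G u {a, b, c, d} := by
  refine ⟨fun y hy => ?_, fun y z hy hyz => ?_, a, fun y hy => ?_⟩
  · simp only [Finset.mem_insert, Finset.mem_singleton] at hy
    rcases hy with rfl | rfl | rfl | rfl
    exacts [h.hab.2.1, h.hbc.2.1, h.hcd.2.1, h.hda.2.1]
  · simp only [Finset.mem_insert, Finset.mem_singleton] at hy ⊢
    exact h.closed y z hy hyz
  · simp only [Finset.mem_insert, Finset.mem_singleton] at hy
    rcases hy with rfl | rfl | rfl | rfl
    exacts [SimpleGraph.Reachable.refl _, h.hab.reachable,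
      h.hab.reachable.trans h.hbc.reachable, h.hda.symm.reachable]

/-- The total loss at `v` caused by the outer neighbours of `v`. -/
noncomputable def lossAt (G : SimpleGraph V) [DecidableRel G.Adj] (u : V) (x : V → ℝ) (v : V) : ℝ :=
  ∑ w ∈ outNbrs G u v, outerLoss G u x w

theorem gain_eq (u : V) (x : V → ℝ) (v : V) :
    gain G u x v = (((inNbrs G u v).card : ℝ) - 1) * x v - ((inNbrs G u v).card : ℝ) / 2
      - lossAt G u x v := rfl

omit [DecidableEq V] in
theorem inNbrs_leaf_c {u c d y : V} (h : IsTreeComponent (linkGraph G u) c d)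
    (hy : y ∈ inNbrs G u c) (hyd : y ≠ d) : inNbrs G u y = {c} := by
  have hc := h.hcd.2.1
  have hy' := (linkGraph_adj hc).2 hy
  ext z
  rw [← linkGraph_adj hy'.2.2, Finset.mem_singleton]
  exact ⟨h.leaf_c y z hy' hyd, fun hz => hz ▸ hy'.symm⟩

theorem IsTreeComponent.symm {V : Type*} {H : SimpleGraph V} {c d : V}
    (h : IsTreeComponent H c d) : IsTreeComponent H d c :=
  ⟨h.hcd.symm, h.leaf_d, h.leaf_c⟩

omit [DecidableEq V] in
theorem IsTreeComponent.disjoint {u c d : V} (h : IsTreeComponent (linkGraph G u) c d) :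
    Disjoint (inNbrs G u c) (inNbrs G u d) := by
  rw [Finset.disjoint_left]
  intro y hy hy'
  rw [← linkGraph_adj h.hcd.2.1] at hy
  rw [← linkGraph_adj h.hcd.2.2] at hy'
  have : y ≠ d := hy'.ne.symm
  exact h.hcd.ne (h.leaf_c y d hy this hy'.symm).symm

/-- Apart from losses, a leaf contributes `-1 / 2`, and a centre of link degree `k` contributes `(k
- 1) * x - k / 2`. A centre together with its `k - 1` leaves thus gives `(k - 1) * (x - 1) - 1 / 2`.
-/
theorem IsTreeComponent.sum_gain {u c d : V} (x : V → ℝ)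
    (h : IsTreeComponent (linkGraph G u) c d) :
    ∑ v ∈ inNbrs G u c ∪ inNbrs G u d, gain G u x v
      = (((inNbrs G u c).card : ℝ) - 1) * (x c - 1) + (((inNbrs G u d).card : ℝ) - 1) * (x d - 1)
        - 1 - ∑ v ∈ inNbrs G u c ∪ inNbrs G u d, lossAt G u x v := by
  -- The neighbours of `c` are its leaves and `d`, so this half of the sum involves `x d` and not `x
  -- c`.
  have key : ∀ c d, IsTreeComponent (linkGraph G u) c d →
      ∑ v ∈ inNbrs G u c, gain G u x v = (((inNbrs G u d).card : ℝ) - 1) * x d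
        - ((inNbrs G u d).card : ℝ) / 2 - (((inNbrs G u c).card : ℝ) - 1) / 2
        - ∑ v ∈ inNbrs G u c, lossAt G u x v := by
    intro c d h
    have hd : d ∈ inNbrs G u c := (linkGraph_adj h.hcd.2.1).1 h.hcd
    have h1 : ∑ v ∈ (inNbrs G u c).erase d, gain G u x v
        = ∑ v ∈ (inNbrs G u c).erase d, (-1 / 2 - lossAt G u x v) := by
      refine Finset.sum_congr rfl fun y hy => ?_
      rw [Finset.mem_erase] at hy
      rw [gain_eq, inNbrs_leaf_c h hy.2 hy.1]
      simp
      ring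
    rw [← Finset.sum_erase_add _ _ hd, h1, ← Finset.sum_erase_add _ _ hd, Finset.sum_sub_distrib,
      Finset.sum_const, Finset.card_erase_of_mem hd, nsmul_eq_mul, gain_eq,
      Nat.cast_sub (Finset.card_pos.2 ⟨d, hd⟩)]
    push_cast
    ring
  rw [Finset.sum_union h.disjoint, Finset.sum_union h.disjoint, key c d h, key d c h.symm]
  ring

theorem IsTriangleComponent.inNbrs_p {u c p q : V} (h : IsTriangleComponent (linkGraph G u) c p q) :
    inNbrs G u p = {c, q} := by
  ext z
  rw [← linkGraph_adj h.hcp.2.2, Finset.mem_insert, Finset.mem_singleton]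
  exact ⟨h.adj_p z, by rintro (rfl | rfl); exacts [h.hcp.symm, h.hpq]⟩

theorem IsTriangleComponent.swap {V : Type*} {H : SimpleGraph V} {c p q : V}
    (h : IsTriangleComponent H c p q) : IsTriangleComponent H c q p :=
  ⟨h.hcq, h.hcp, h.hpq.symm, h.adj_q, h.adj_p, fun y z h1 h2 h3 => h.leaf y z h1 h3 h2⟩

namespace IsPerronVector
variable {lam : ℝ} {u : V} {x : V → ℝ} (hx : IsPerronVector G lam u x)
include hx

theorem lossAt_nonneg (v : V) : 0 ≤ lossAt G u x v :=
  Finset.sum_nonneg fun w _ => hx.outerLoss_nonneg w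

/-- With `k` the link degree of `c`, the centre and its `k - 2` leaves give at most `(k - 1) * (x c
- 1)`, and `p`, `q` give `x - 1` each before losses. -/
theorem sum_gain_triangle_le {c p q : V} (h : IsTriangleComponent (linkGraph G u) c p q) :
    ∑ v ∈ insert c (inNbrs G u c), gain G u x v
      ≤ x p + x q - 2 - lossAt G u x p - lossAt G u x q
        + (((inNbrs G u c).card : ℝ) - 1) * (x c - 1) := by
  have hc := h.hcp.2.1
  have hp : p ∈ inNbrs G u c := (linkGraph_adj hc).1 h.hcp
  have hq : q ∈ (inNbrs G u c).erase p :=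
    Finset.mem_erase.2 ⟨h.hpq.ne.symm, (linkGraph_adj hc).1 h.hcq⟩
  have h2 : ∑ v ∈ ((inNbrs G u c).erase p).erase q, gain G u x v
      ≤ ∑ v ∈ ((inNbrs G u c).erase p).erase q, (-1 / 2 : ℝ) := by
    refine Finset.sum_le_sum fun y hy => ?_
    simp only [Finset.mem_erase] at hy
    have hy' := (linkGraph_adj hc).2 hy.2.2
    have : inNbrs G u y = {c} := by
      ext z
      rw [← linkGraph_adj hy'.2.2, Finset.mem_singleton]
      exact ⟨h.leaf y z hy' hy.2.1 hy.1, fun hz => hz ▸ hy'.symm⟩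
    have hl := hx.lossAt_nonneg y
    rw [gain_eq, this]
    simp
    linarith
  have hcard : ((((inNbrs G u c).erase p).erase q).card : ℝ) = (inNbrs G u c).card - 2 := by
    rw [Finset.card_erase_of_mem hq, Finset.card_erase_of_mem hp]
    have h1 := Finset.card_pos.2 ⟨q, hq⟩
    rw [Finset.card_erase_of_mem hp] at h1
    rw [Nat.cast_sub h1, Nat.cast_sub (by omega)]
    push_cast
    ring
  rw [Finset.sum_const, nsmul_eq_mul, hcard] at h2
  have gp : gain G u x p = x p - 1 - lossAt G u x p := by
    rw [gain_eq, h.inNbrs_p, Finset.card_pair h.hcq.ne]; push_cast; ring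
  have gq : gain G u x q = x q - 1 - lossAt G u x q := by
    rw [gain_eq, h.swap.inNbrs_p, Finset.card_pair h.hcp.ne]; push_cast; ring
  have hl := hx.lossAt_nonneg c
  rw [Finset.sum_insert (by simp [mem_inNbrs]), ← Finset.sum_erase_add _ _ hp,
    ← Finset.sum_erase_add _ _ hq, gp, gq, gain_eq]
  linarith

theorem gain_neg_of_isolated {v : V} (hv : G.Adj u v) (h : ∀ w, ¬ (linkGraph G u).Adj v w) :
    gain G u x v < 0 := by
  have h0 : inNbrs G u v = ∅ := by
    ext w
    rw [← linkGraph_adj hv]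
    simp [h w]
  have hl := hx.lossAt_nonneg v
  rw [gain_eq, h0]
  simp
  linarith [hx.pos_of_adj hv]

theorem sum_gain_tree_le {c d : V} (h : IsTreeComponent (linkGraph G u) c d) :
    ∑ v ∈ inNbrs G u c ∪ inNbrs G u d, gain G u x v ≤ -1 := by
  rw [h.sum_gain]
  have h1 : (1 : ℝ) ≤ (inNbrs G u c).card := by
    exact_mod_cast Finset.card_pos.2 ⟨d, (linkGraph_adj h.hcd.2.1).1 h.hcd⟩
  have h2 : (1 : ℝ) ≤ (inNbrs G u d).card := by
    exact_mod_cast Finset.card_pos.2 ⟨c, (linkGraph_adj h.hcd.2.2).1 h.hcd.symm⟩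
  have h3 := Finset.sum_nonneg fun v (_ : v ∈ inNbrs G u c ∪ inNbrs G u d) => hx.lossAt_nonneg v
  nlinarith [hx.le_one c, hx.le_one d]

/-- Equality in the spectral count forces the complete split graph. -/
theorem rigidity (hlam : 3 < lam) (hiso : ∀ v : V, ∃ w : V, G.Adj v w) {c d : V}
    (ht : IsTreeComponent (linkGraph G u) c d)
    (hneg : ∀ v, G.Adj u v → ∃ T, IsLinkComponent G u T ∧ v ∈ T ∧ ∑ y ∈ T, gain G u x y < 0)
    (hleaves : ∀ w y z, w ∈ outer G u → G.Adj w y → G.Adj w z → y ≠ z →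
      ((linkGraph G u).Adj c y ∨ (linkGraph G u).Adj d y) → y ≠ c → y ≠ d →
      ((linkGraph G u).Adj c z ∨ (linkGraph G u).Adj d z) → z ≠ c → z ≠ d → False)
    (hm : (G.edgeFinset.card : ℝ) - 1 ≤ lam ^ 2 - lam) :
    lam ^ 2 - lam = G.edgeFinset.card - 1 ∧
      ∃ c, G.Adj u c ∧ ∀ v w, G.Adj v w ↔ v ≠ w ∧ (v = u ∨ v = c ∨ w = u ∨ w = c) := by
  have hcount := hx.spectral_count
  have hR := Finset.sum_nonneg fun w (_ : w ∈ (outer G u).filter fun w => inNbrs G u w = ∅) =>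
    (by positivity : (0 : ℝ) ≤ ((outNbrs G u w).card : ℝ) / 2)
  have hTle := hx.sum_gain_tree_le ht
  obtain ⟨hle, heq⟩ := sum_le_of_component hneg ht.isLinkComponent
  -- The count needs total gain at least `-1`, while this component already has at most `-1`. All
  -- inequalities in between are therefore equalities, and the component is the whole link.
  have hTN := heq (by linarith)
  have hsum := ht.sum_gain x
  have h1 : (1 : ℝ) ≤ (inNbrs G u c).card := by
    exact_mod_cast Finset.card_pos.2 ⟨d, (linkGraph_adj ht.hcd.2.1).1 ht.hcd⟩
  have h2 : (1 : ℝ) ≤ (inNbrs G u d).card := by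
    exact_mod_cast Finset.card_pos.2 ⟨c, (linkGraph_adj ht.hcd.2.2).1 ht.hcd.symm⟩
  have hloss0 := Finset.sum_nonneg fun v (_ : v ∈ inNbrs G u c ∪ inNbrs G u d) =>
    hx.lossAt_nonneg v
  have hc1 : (((inNbrs G u c).card : ℝ) - 1) * (x c - 1) ≤ 0 :=
    mul_nonpos_of_nonneg_of_nonpos (by linarith) (by linarith [hx.le_one c])
  have hd1 : (((inNbrs G u d).card : ℝ) - 1) * (x d - 1) ≤ 0 :=
    mul_nonpos_of_nonneg_of_nonpos (by linarith) (by linarith [hx.le_one d])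
  have hc0 : (((inNbrs G u c).card : ℝ) - 1) * (x c - 1) = 0 := by linarith
  have hd0 : (((inNbrs G u d).card : ℝ) - 1) * (x d - 1) = 0 := by linarith
  have hL : ∑ v ∈ inNbrs G u c ∪ inNbrs G u d, lossAt G u x v = 0 := by linarith
  have hR0 : ∑ w ∈ (outer G u).filter (fun w => inNbrs G u w = ∅),
      ((outNbrs G u w).card : ℝ) / 2 = 0 := by linarith
  have hNadj : ∀ y, G.Adj u y ↔ y ∈ inNbrs G u c ∪ inNbrs G u d := by
    intro y; rw [hTN, SimpleGraph.mem_neighborFinset]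
  have hNadj' : ∀ y, G.Adj u y → (linkGraph G u).Adj c y ∨ (linkGraph G u).Adj d y := by
    intro y hy
    rwa [hNadj, Finset.mem_union, ← linkGraph_adj ht.hcd.2.1, ← linkGraph_adj ht.hcd.2.2] at hy
  -- there are no outer vertices
  have hout : ∀ w, w ∉ outer G u := by
    intro w hw
    have hw' := mem_outer.1 hw
    have hcard : ((inNbrs G u w).card : ℝ) < 4 := by
      -- By `hleaves`, `w` sees at most one leaf, hence at most three vertices of the link. Zero
      -- loss would make `x w = 1` with no outer neighbours, and then `lam ≤ 3`.
      have h3 : (inNbrs G u w \ {c, d}).card ≤ 1 := by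
        rw [Finset.card_le_one]
        intro y hy z hz
        by_contra hyz
        simp only [Finset.mem_sdiff, Finset.mem_insert, Finset.mem_singleton, not_or,
          mem_inNbrs] at hy hz
        exact hleaves w y z hw hy.1.1 hz.1.1 hyz (hNadj' y hy.1.2) hy.2.1 hy.2.2
          (hNadj' z hz.1.2) hz.2.1 hz.2.2
      have h4 := Finset.le_card_sdiff {c, d} (inNbrs G u w)
      have h5 : ({c, d} : Finset V).card ≤ 2 := Finset.card_le_two
      exact_mod_cast (by omega : (inNbrs G u w).card < 4)
    have hwle := hx.lam_mul_le hw
    -- With no neighbour in the link, the vanishing remainder leaves `w` isolated.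
    by_cases h0 : inNbrs G u w = ∅
    · have := (Finset.sum_eq_zero_iff_of_nonneg (fun w _ => by positivity)).1 hR0 w
        (Finset.mem_filter.2 ⟨hw, h0⟩)
      have h6 : outNbrs G u w = ∅ := by simpa using this
      obtain ⟨z, hz⟩ := hiso w
      by_cases hzu : G.Adj u z
      · have : z ∈ inNbrs G u w := mem_inNbrs.2 ⟨hz, hzu⟩
        simp [h0] at this
      · have : z ∈ outNbrs G u w := mem_outNbrs.2 ⟨hz, by rintro rfl; exact hw'.2 hz.symm, hzu⟩
        simp [h6] at this
    · obtain ⟨y, hy⟩ := Finset.nonempty_iff_ne_empty.2 h0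
      rw [mem_inNbrs] at hy
      have h7 := (Finset.sum_eq_zero_iff_of_nonneg (fun v _ => hx.lossAt_nonneg v)).1 hL y
        ((hNadj y).1 hy.2)
      have h8 := (Finset.sum_eq_zero_iff_of_nonneg (fun v _ => hx.outerLoss_nonneg v)).1 h7 w
        (mem_outNbrs.2 ⟨hy.1.symm, hw'⟩)
      have hpos : (0 : ℝ) < (inNbrs G u w).card := by
        exact_mod_cast Finset.card_pos.2 (Finset.nonempty_iff_ne_empty.2 h0)
      have h9 : 0 ≤ ((outNbrs G u w).card : ℝ) / (2 * (inNbrs G u w).card) := by positivity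
      unfold outerLoss at h8
      have hx1 : x w = 1 := le_antisymm (hx.le_one w) (by linarith)
      have h10 : ((outNbrs G u w).card : ℝ) = 0 := by
        have : ((outNbrs G u w).card : ℝ) / (2 * (inNbrs G u w).card) = 0 := by linarith
        rcases div_eq_zero_iff.1 this with h | h
        · exact h
        · linarith
      rw [hx1, h10] at hwle
      have h11 : (3 : ℝ) < (inNbrs G u w).card := by linarith
      have h13 : 4 ≤ (inNbrs G u w).card := by
        have : 3 < (inNbrs G u w).card := by exact_mod_cast h11
        omega
      have : (4 : ℝ) ≤ (inNbrs G u w).card := by exact_mod_cast h13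
      linarith
  have houtN : ∀ v, outNbrs G u v = ∅ := by
    intro v
    rw [Finset.eq_empty_iff_forall_notMem]
    exact fun w hw => hout w (mem_outer.2 (mem_outNbrs.1 hw).2)
  -- one of the two centres is a leaf
  have hstar : (inNbrs G u c).card = 1 ∨ (inNbrs G u d).card = 1 := by
    by_contra! hcon
    have hc' : x c = 1 := by
      rcases mul_eq_zero.1 hc0 with h | h
      · exact (hcon.1 (by exact_mod_cast (by linarith : ((inNbrs G u c).card : ℝ) = 1))).elim
      · linarith
    have hd' : x d = 1 := by
      rcases mul_eq_zero.1 hd0 with h | h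
      · exact (hcon.2 (by exact_mod_cast (by linarith : ((inNbrs G u d).card : ℝ) = 1))).elim
      · linarith
    -- With `x c = 1`, the equation at `c` makes `lam` equal to `1` plus the weight around `c`; the
    -- equation at `u` makes it the weight around `c` plus that around `d`. The latter exceeds `1`,
    -- because it contains `x c = 1` and a leaf.
    have e1 := hx.eig_nbr ht.hcd.2.1
    have e2 := hx.sum_nbrs
    rw [← hTN, Finset.sum_union ht.disjoint] at e2
    rw [houtN, hc'] at e1
    simp only [Finset.sum_empty] at e1
    have hcd : c ∈ inNbrs G u d := (linkGraph_adj ht.hcd.2.2).1 ht.hcd.symm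
    have hne : ((inNbrs G u d).erase c).Nonempty := by
      rw [← Finset.card_pos, Finset.card_erase_of_mem hcd]
      have := Finset.card_pos.2 ⟨c, hcd⟩
      omega
    have hp := Finset.sum_pos (fun y (hy : y ∈ (inNbrs G u d).erase c) =>
      hx.pos_of_adj (mem_inNbrs.1 (Finset.mem_erase.1 hy).2).2) hne
    rw [← Finset.sum_erase_add _ _ hcd, hc'] at e2
    linarith
  refine ⟨by linarith, ?_⟩
  have finish : ∀ c d, IsTreeComponent (linkGraph G u) c d → (inNbrs G u d).card = 1 →
      (∀ y, G.Adj u y → (linkGraph G u).Adj c y ∨ (linkGraph G u).Adj d y) →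
      ∃ c, G.Adj u c ∧ ∀ v w, G.Adj v w ↔ v ≠ w ∧ (v = u ∨ v = c ∨ w = u ∨ w = c) := by
    intro c d ht hd hN
    have hdc : ∀ y, (linkGraph G u).Adj d y → y = c := by
      intro y hy
      rw [linkGraph_adj ht.hcd.2.2] at hy
      exact Finset.card_le_one.1 hd.le y hy c ((linkGraph_adj ht.hcd.2.2).1 ht.hcd.symm)
    have huv : ∀ v, v ≠ u → G.Adj u v := by
      intro v hv
      by_contra h
      exact hout v (mem_outer.2 ⟨hv, h⟩)
    have hcv : ∀ v, v ≠ u → v ≠ c → (linkGraph G u).Adj c v := by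
      intro v hvu hvc
      rcases hN v (huv v hvu) with h | h
      · exact h
      · exact (hvc (hdc v h)).elim
    have hleaf : ∀ v w, (linkGraph G u).Adj v w → v ≠ c → w = c := by
      intro v w hvw hvc
      have hv := hcv v hvw.2.1.ne.symm hvc
      by_cases hvd : v = d
      · subst hvd; exact hdc w hvw
      · exact ht.leaf_c v w hv hvd hvw
    refine ⟨c, ht.hcd.2.1, fun v w => ⟨fun h => ⟨h.ne, ?_⟩, ?_⟩⟩
    · by_contra! hcon
      exact hcon.2.2.2 (hleaf v w ⟨h, huv v hcon.1, huv w hcon.2.2.1⟩ hcon.2.1)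
    · rintro ⟨hvw, rfl | rfl | rfl | rfl⟩
      · exact huv w hvw.symm
      · by_cases hwu : w = u
        · subst hwu; exact ht.hcd.2.1.symm
        · exact (hcv w hwu hvw.symm).1
      · exact (huv v hvw).symm
      · by_cases hvu : v = u
        · subst hvu; exact ht.hcd.2.1
        · exact (hcv v hvu hvw).1.symm
  rcases hstar with h | h
  · exact finish d c ht.symm h fun y hy => (hNadj' y hy).symm
  · exact finish c d ht h hNadj'

end IsPerronVector
end Components

/-! ### The case of `θ_{1,2,4}`. -/

section Hexagon
variable {V : Type*} [Fintype V] [DecidableEq V] {G : SimpleGraph V} [DecidableRel G.Adj]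

omit [Fintype V] [DecidableEq V] [DecidableRel G.Adj] in
-- A path `a b c d e` in the link closes through `u` to a six-cycle with chord `u b`.
theorem noPathFive_of_hexagonFree (hG : (thetaGraph 1 2 4).Free G) (u : V) :
    NoPathFive (linkGraph G u) := fun a b c d e hab hbc hcd hde hac had hae hbd hbe hce =>
  no_hexagon_of_free hG u a b c d e hab.2.1 hab.1 hbc.1 hcd.1 hde.1 hde.2.2.symm hab.2.2
    hcd.2.1.ne hde.2.1.ne hac had hae hbd hbe hce

theorem IsQuadComponent.rotate {V : Type*} {H : SimpleGraph V} {a b c d : V}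
    (h : IsQuadComponent H a b c d) : IsQuadComponent H b c d a := by
  refine ⟨h.hbc, h.hcd, h.hda, h.hab, h.hbd, h.hac.symm, fun y z hy hyz => ?_⟩
  have := h.closed y z (by tauto) hyz
  tauto

/-- For another link neighbour `z` of `w`, the path `a w z` closes through `u` and vertices of the
quadrilateral to a six-cycle with a short chord at `u`. -/
theorem IsQuadComponent.inNbrs_outer (hG : (thetaGraph 1 2 4).Free G) {u a b c d w : V}
    (h : IsQuadComponent (linkGraph G u) a b c d) (hw : w ∈ outNbrs G u a) :
    inNbrs G u w = {a} := by
  rw [mem_outNbrs] at hw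
  obtain ⟨haw, hwu, huw⟩ := hw
  have ua := h.hab.2.1; have ub := h.hbc.2.1; have uc := h.hcd.2.1; have ud := h.hda.2.1
  have ab := h.hab.1; have bc := h.hbc.1; have cd := h.hcd.1; have da := h.hda.1
  have wb : w ≠ b := by rintro rfl; exact huw ub
  have wc : w ≠ c := by rintro rfl; exact huw uc
  have wd : w ≠ d := by rintro rfl; exact huw ud
  ext z
  rw [mem_inNbrs, Finset.mem_singleton]
  refine ⟨fun ⟨hwz, huz⟩ => ?_, fun hz => hz ▸ ⟨haw.symm, ua⟩⟩
  by_contra hza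
  by_cases hzb : z = b
  · subst hzb
    exact no_hexagon_of_free hG a d u c z w da.symm ud.symm uc bc.symm hwz.symm haw.symm ua.symm
      h.hac ab.ne cd.ne.symm h.hbd.symm wd.symm ub.ne hwu.symm wc.symm
  by_cases hzd : z = d
  · subst hzd
    exact no_hexagon_of_free hG a b u c z w ab ub.symm uc cd hwz.symm haw.symm ua.symm
      h.hac da.ne.symm bc.ne h.hbd wb.symm ud.ne hwu.symm wc.symm
  by_cases hzc : z = c
  · subst hzc
    exact no_hexagon_of_free hG a b u d z w ab ub.symm ud cd.symm hwz.symm haw.symm ua.symm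
      da.ne.symm h.hac h.hbd bc.ne wb.symm uc.ne hwu.symm wd.symm
  · exact no_hexagon_of_free hG b c u z w a bc uc.symm huz hwz.symm haw.symm ab ub.symm
      (Ne.symm hzb) wb.symm (Ne.symm hzc) wc.symm h.hac.symm hwu.symm ua.ne hza

theorem IsTriangleComponent.inNbrs_outer_subset (hG : (thetaGraph 1 2 4).Free G) {u c p q w : V}
    (h : IsTriangleComponent (linkGraph G u) c p q) (hw : w ∈ outNbrs G u p) :
    inNbrs G u w ⊆ {c, p, q} := by
  rw [mem_outNbrs] at hw
  obtain ⟨hpw, hwu, huw⟩ := hw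
  have uc := h.hcp.2.1; have up := h.hcp.2.2; have uq := h.hcq.2.2
  have wc : w ≠ c := by rintro rfl; exact huw uc
  have wq : w ≠ q := by rintro rfl; exact huw uq
  intro z hz
  rw [mem_inNbrs] at hz
  by_contra hcon
  simp only [Finset.mem_insert, Finset.mem_singleton, not_or] at hcon
  exact no_hexagon_of_free hG p q c u z w h.hpq.1 h.hcq.1.symm uc.symm hz.2 hz.1.symm hpw.symm
    h.hcp.1.symm up.ne.symm (Ne.symm hcon.2.1) uq.ne.symm (Ne.symm hcon.2.2) wq.symm
    (Ne.symm hcon.1) wc.symm hwu.symm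

theorem IsQuadComponent.inNbrs_of_adj {u a b c d : V}
    (h : IsQuadComponent (linkGraph G u) a b c d) (hac : (linkGraph G u).Adj a c) :
    inNbrs G u a = {b, c, d} := by
  ext z
  rw [← linkGraph_adj hac.2.1]
  simp only [Finset.mem_insert, Finset.mem_singleton]
  constructor
  · intro hz
    rcases h.closed a z (Or.inl rfl) hz with rfl | hz'
    · exact (hz.ne rfl).elim
    · exact hz'
  · rintro (rfl | rfl | rfl)
    exacts [h.hab, hac, h.hda.symm]

theorem IsQuadComponent.inNbrs_of_not_adj {u a b c d : V}
    (h : IsQuadComponent (linkGraph G u) a b c d) (hac : ¬ (linkGraph G u).Adj a c) :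
    inNbrs G u a = {b, d} := by
  ext z
  rw [← linkGraph_adj h.hab.2.1]
  simp only [Finset.mem_insert, Finset.mem_singleton]
  constructor
  · intro hz
    rcases h.closed a z (Or.inl rfl) hz with rfl | rfl | rfl | rfl
    · exact (hz.ne rfl).elim
    · exact Or.inl rfl
    · exact (hac hz).elim
    · exact Or.inr rfl
  · rintro (rfl | rfl)
    exacts [h.hab, h.hda.symm]

namespace IsPerronVector
variable {lam : ℝ} {u : V} {x : V → ℝ} (hx : IsPerronVector G lam u x)
include hx

/-- With `e` the outer degree of `w`, the claim is `2 * x w ≤ 1 + e / 2`, which follows from `5 * x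
w ≤ 1 + e`. -/
theorem le_outerLoss_of_card_eq_one (hlam : 5 < lam) {w : V} (hw : w ∈ outer G u)
    (h : (inNbrs G u w).card = 1) : x w ≤ outerLoss G u x w := by
  have h1 := hx.lam_mul_le hw
  have h2 := hx.nonneg w
  unfold outerLoss
  rw [h] at h1 ⊢
  push_cast at h1 ⊢
  have h3 : (0 : ℝ) ≤ (outNbrs G u w).card := by positivity
  nlinarith

/-- With `e` the outer degree of `w`, it suffices that `4 * x w ≤ 3 + e / 2`, the average of `5 * x
w ≤ 3 + e` and `3 * x w ≤ 3`. -/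
theorem le_three_mul_outerLoss (hlam : 5 < lam) {w : V} (hw : w ∈ outer G u)
    (h0 : (inNbrs G u w).Nonempty) (h : (inNbrs G u w).card ≤ 3) :
    x w ≤ 3 * outerLoss G u x w := by
  have h1 := hx.lam_mul_le hw
  have h2 := hx.nonneg w
  have hle := hx.le_one w
  have h3 : (0 : ℝ) ≤ (outNbrs G u w).card := by positivity
  have h4 : (0 : ℝ) < (inNbrs G u w).card := by exact_mod_cast Finset.card_pos.2 h0
  have h5 : ((inNbrs G u w).card : ℝ) ≤ 3 := by exact_mod_cast h
  have h6 : ((outNbrs G u w).card : ℝ) / 6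
      ≤ ((outNbrs G u w).card : ℝ) / (2 * (inNbrs G u w).card) :=
    div_le_div_of_nonneg_left h3 (by linarith) (by linarith)
  have h7 : 5 * x w ≤ 3 + (outNbrs G u w).card := by nlinarith
  unfold outerLoss
  linarith

/-- Let `S` be the weight of the four vertices. Their eigenvalue equations give outer weight at
least `(lam - 3) * S - 4 > 2 * S - 4`, and the loss is at least that. Large entries thus pay for
themselves, whichever chords are present. -/
theorem sum_gain_quad_lt (hlam : 5 < lam) (hG : (thetaGraph 1 2 4).Free G) {a b c d : V}
    (h : IsQuadComponent (linkGraph G u) a b c d) :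
    ∑ v ∈ {a, b, c, d}, gain G u x v < -1 := by
  have key : ∀ a b c d : V, IsQuadComponent (linkGraph G u) a b c d →
      ∑ w ∈ outNbrs G u a, x w ≤ lossAt G u x a ∧
      lam * x a ≤ 1 + (x b + x c + x d) + ∑ w ∈ outNbrs G u a, x w ∧
      ((linkGraph G u).Adj a c → gain G u x a = 2 * x a - 3 / 2 - lossAt G u x a) ∧
      (¬ (linkGraph G u).Adj a c → gain G u x a = x a - 1 - lossAt G u x a) := by
    intro a b c d h
    refine ⟨Finset.sum_le_sum fun w hw => ?_, ?_, fun hac => ?_, fun hac => ?_⟩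
    · exact hx.le_outerLoss_of_card_eq_one hlam (mem_outer.2 (mem_outNbrs.1 hw).2)
        (by rw [h.inNbrs_outer hG hw, Finset.card_singleton])
    · rw [hx.eig_nbr h.hab.2.1]
      by_cases hac : (linkGraph G u).Adj a c
      · rw [h.inNbrs_of_adj hac, Finset.sum_insert, Finset.sum_pair h.hcd.ne]
        · linarith
        · simp only [Finset.mem_insert, Finset.mem_singleton, not_or]
          exact ⟨h.hbc.ne, h.hbd⟩
      · rw [h.inNbrs_of_not_adj hac, Finset.sum_pair h.hbd]
        linarith [hx.nonneg c]
    · rw [gain_eq, h.inNbrs_of_adj hac, Finset.card_eq_three.2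
        ⟨b, c, d, h.hbc.ne, h.hbd, h.hcd.ne, rfl⟩]
      push_cast; ring
    · rw [gain_eq, h.inNbrs_of_not_adj hac, Finset.card_pair h.hbd]
      push_cast; ring
  obtain ⟨a1, a2, a3, a4⟩ := key a b c d h
  obtain ⟨b1, b2, b3, b4⟩ := key b c d a h.rotate
  obtain ⟨c1, c2, c3, c4⟩ := key c d a b h.rotate.rotate
  obtain ⟨d1, d2, d3, d4⟩ := key d a b c h.rotate.rotate.rotate
  have ha0 := hx.pos_of_adj h.hab.2.1
  have hb0 := hx.nonneg b
  have hc0 := hx.nonneg c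
  have hd0 := hx.nonneg d
  have hS : 5 * (x a + x b + x c + x d) < lam * (x a + x b + x c + x d) :=
    mul_lt_mul_of_pos_right hlam (by linarith)
  rw [Finset.sum_insert, Finset.sum_insert, Finset.sum_pair h.hcd.ne]
  rotate_left
  · simp only [Finset.mem_insert, Finset.mem_singleton, not_or]
    exact ⟨h.hbc.ne, h.hbd⟩
  · simp only [Finset.mem_insert, Finset.mem_singleton, not_or]
    exact ⟨h.hab.ne, h.hac, h.hda.ne.symm⟩
  by_cases hac : (linkGraph G u).Adj a c <;> by_cases hbd : (linkGraph G u).Adj b d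
  · rw [a3 hac, b3 hbd, c3 hac.symm, d3 hbd.symm]; linarith
  · rw [a3 hac, b4 hbd, c3 hac.symm, d4 fun h => hbd h.symm]; linarith
  · rw [a4 hac, b3 hbd, c4 fun h => hac h.symm, d3 hbd.symm]; linarith
  · rw [a4 hac, b4 hbd, c4 fun h => hac h.symm, d4 fun h => hbd h.symm]
    linarith [hx.lossAt_nonneg a, hx.lossAt_nonneg b, hx.lossAt_nonneg c, hx.lossAt_nonneg d]

/-- With `S = x p + x q` and `L` the loss at `p` and `q`, the eigenvalue equations give `4 * S < 4 +
3 * L`, whence `S - 2 - L < -1`. -/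
theorem sum_gain_triangle_lt (hlam : 5 < lam) (hG : (thetaGraph 1 2 4).Free G) {c p q : V}
    (h : IsTriangleComponent (linkGraph G u) c p q) :
    ∑ v ∈ insert c (inNbrs G u c), gain G u x v < -1 := by
  have key : ∀ p q : V, IsTriangleComponent (linkGraph G u) c p q →
      ∑ w ∈ outNbrs G u p, x w ≤ 3 * lossAt G u x p ∧
      lam * x p = 1 + (x c + x q) + ∑ w ∈ outNbrs G u p, x w := by
    intro p q h
    constructor
    · rw [lossAt, Finset.mul_sum]
      refine Finset.sum_le_sum fun w hw => ?_
      refine hx.le_three_mul_outerLoss hlam (mem_outer.2 (mem_outNbrs.1 hw).2)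
        ⟨p, mem_inNbrs.2 ⟨(mem_outNbrs.1 hw).1.symm, h.hcp.2.2⟩⟩ ?_
      exact (Finset.card_le_card (h.inNbrs_outer_subset hG hw)).trans Finset.card_le_three
    · rw [hx.eig_nbr h.hcp.2.2, h.inNbrs_p, Finset.sum_pair h.hcq.ne]
  obtain ⟨p1, p2⟩ := key p q h
  obtain ⟨q1, q2⟩ := key q p h.swap
  have hle := hx.sum_gain_triangle_le h
  have hp0 := hx.pos_of_adj h.hcp.2.2
  have hq0 := hx.pos_of_adj h.hcq.2.2
  have hc1 := hx.le_one c
  have hS : 5 * (x p + x q) < lam * (x p + x q) :=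
    mul_lt_mul_of_pos_right hlam (by linarith)
  have h1 : (1 : ℝ) ≤ (inNbrs G u c).card := by
    exact_mod_cast Finset.card_pos.2 ⟨p, (linkGraph_adj h.hcp.2.1).1 h.hcp⟩
  have hc2 : (((inNbrs G u c).card : ℝ) - 1) * (x c - 1) ≤ 0 :=
    mul_nonpos_of_nonneg_of_nonpos (by linarith) (by linarith)
  have l1 := hx.lossAt_nonneg p
  have l2 := hx.lossAt_nonneg q
  linarith

theorem sum_nbrs_gain_le_of_isolated (h : ∀ v, G.Adj u v → ∀ w, ¬ (linkGraph G u).Adj v w) :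
    ∑ v ∈ G.neighborFinset u, gain G u x v ≤ -lam := by
  rw [← hx.sum_nbrs, ← Finset.sum_neg_distrib]
  refine Finset.sum_le_sum fun v hv => ?_
  rw [SimpleGraph.mem_neighborFinset] at hv
  have h0 : inNbrs G u v = ∅ := by
    ext w
    rw [← linkGraph_adj hv]
    simp [h v hv w]
  have hl := hx.lossAt_nonneg v
  rw [gain_eq, h0]
  simp
  linarith

theorem hexagonFree_extremal (hlam : 5 < lam) (hG : (thetaGraph 1 2 4).Free G)
    (hiso : ∀ v : V, ∃ w : V, G.Adj v w)
    (hm : (G.edgeFinset.card : ℝ) - 1 ≤ lam ^ 2 - lam) :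
    lam ^ 2 - lam = G.edgeFinset.card - 1 ∧
      ∃ c, G.Adj u c ∧ ∀ v w, G.Adj v w ↔ v ≠ w ∧ (v = u ∨ v = c ∨ w = u ∨ w = c) := by
  have h5 := noPathFive_of_hexagonFree hG u
  have hneg : ∀ v, G.Adj u v → ∃ T, IsLinkComponent G u T ∧ v ∈ T ∧
      ∑ y ∈ T, gain G u x y < 0 := by
    intro v hv
    rcases h5.classify v with h | ⟨a, b, c, d, h, hm⟩ | ⟨c, p, q, h, hm⟩ | ⟨c, d, h, hm⟩
    · exact ⟨{v}, isLinkComponent_singleton hv h, by simp,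
        by simpa using hx.gain_neg_of_isolated hv h⟩
    · exact ⟨_, h.isLinkComponent, by simpa using hm,
        (hx.sum_gain_quad_lt hlam hG h).trans (by norm_num)⟩
    · refine ⟨_, h.isLinkComponent, ?_, (hx.sum_gain_triangle_lt hlam hG h).trans (by norm_num)⟩
      rwa [Finset.mem_insert, ← linkGraph_adj h.hcp.2.1]
    · refine ⟨_, h.isLinkComponent, ?_, (hx.sum_gain_tree_le h).trans_lt (by norm_num)⟩
      rwa [Finset.mem_union, ← linkGraph_adj h.hcd.2.1, ← linkGraph_adj h.hcd.2.2]
  have hcount := hx.spectral_count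
  have hR := Finset.sum_nonneg fun w (_ : w ∈ (outer G u).filter fun w => inNbrs G u w = ∅) =>
    (by positivity : (0 : ℝ) ≤ ((outNbrs G u w).card : ℝ) / 2)
  by_cases hex : ∃ v, G.Adj u v ∧ ∃ w, (linkGraph G u).Adj v w
  · obtain ⟨v, hv, w, hvw⟩ := hex
    rcases h5.classify v with h | ⟨a, b, c, d, h, -⟩ | ⟨c, p, q, h, -⟩ | ⟨c, d, h, -⟩
    · exact (h w hvw).elim
    · have := (sum_le_of_component hneg h.isLinkComponent).1
      linarith [hx.sum_gain_quad_lt hlam hG h]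
    · have := (sum_le_of_component hneg h.isLinkComponent).1
      linarith [hx.sum_gain_triangle_lt hlam hG h]
    · refine hx.rigidity (by linarith) hiso h hneg ?_ hm
      -- Two leaves `y`, `z` seen by `w`, with `y` attached to `c`, give the six-cycle `c d u z w y`
      -- with chord `c u`.
      intro w y z hw hwy hwz hyz hy hyc hyd hz hzc hzd
      obtain ⟨hwu, huw⟩ := mem_outer.1 hw
      have uc := h.hcd.2.1; have ud := h.hcd.2.2
      have huz : G.Adj u z := by rcases hz with hz | hz <;> exact hz.2.2
      have huy : G.Adj u y := by rcases hy with hy | hy <;> exact hy.2.2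
      have wc : w ≠ c := by rintro rfl; exact huw uc
      have wd : w ≠ d := by rintro rfl; exact huw ud
      rcases hy with hy | hy
      · exact no_hexagon_of_free hG c d u z w y h.hcd.1 ud.symm huz hwz.symm hwy hy.1.symm
          uc.symm hzc.symm wc.symm hzd.symm wd.symm hyd.symm hwu.symm huy.ne hyz.symm
      · exact no_hexagon_of_free hG d c u z w y h.hcd.1.symm uc.symm huz hwz.symm hwy hy.1.symm
          ud.symm hzd.symm wd.symm hzc.symm wc.symm hyc.symm hwu.symm huy.ne hyz.symm
  · push Not at hex
    linarith [hx.sum_nbrs_gain_le_of_isolated hex]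

end IsPerronVector
end Hexagon

/-! ### The case of `θ_{1,2,3}`. -/

section House

/-- For the `n` vertices on triangles of the link, `S` is their weight, `K` the number of edges from
them to outer vertices, and `A` the weight of the outer ends of these edges. -/
theorem triangle_count_false {lam S A K : ℝ} {n : ℕ} (hlam : 3 < lam) (hlam8 : 7 ≤ lam ^ 2 - lam)
    (hmn : 2 * (n : ℝ) - 1 ≤ lam ^ 2 - lam) (heig : lam * S = n + 2 * S + A)
    (hAl : lam * A ≤ K) (hK : 0 ≤ K) (hcount : 0 ≤ 1 + 2 * S - lam - n - K + A)
    (hcard : n = 0 ∨ n = 3 ∨ 6 ≤ n) : False := by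
  -- The factor `lam - 2` eliminates `S`, because `(lam - 2) * S = n + A`.
  have h2 : 0 ≤ (1 + 2 * S - lam - n - K + A) * (lam - 2) :=
    mul_nonneg hcount (by linarith)
  have h3 : 0 ≤ K * (lam - 3) := mul_nonneg hK (by linarith)
  have h4 : (lam - 1) * (lam - 2) + (n : ℝ) * (lam - 4) ≤ 0 := by linarith
  rcases hcard with rfl | rfl | hn
  · push_cast at h4
    nlinarith
  · push_cast at h4
    nlinarith
  -- Here `lam < 4`, so `hmn` gives `n < 13 / 2`; together with `n ≥ 6` it also gives `lam ^ 2 - lam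
  -- ≥ 11`, too large for `h4`.
  · have hn' : (6 : ℝ) ≤ n := by exact_mod_cast hn
    have h5 : lam < 4 := by
      by_contra! h
      nlinarith
    have h6 : lam ^ 2 - lam < 12 := by nlinarith
    have h7 : 0 ≤ (13 / 2 - (n : ℝ)) * (4 - lam) := mul_nonneg (by linarith) (by linarith)
    linarith

variable {V : Type*} [Fintype V] [DecidableEq V] {G : SimpleGraph V} [DecidableRel G.Adj]

omit [Fintype V] [DecidableEq V] [DecidableRel G.Adj] in
theorem no_pathFour_of_houseFree (hG : (thetaGraph 1 2 3).Free G) {u a b c d : V}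
    (hab : (linkGraph G u).Adj a b) (hbc : (linkGraph G u).Adj b c)
    (hcd : (linkGraph G u).Adj c d) (hac : a ≠ c) (had : a ≠ d) (hbd : b ≠ d) : False :=
  no_house_of_free hG u a b c d hab.2.1 hab.1 hbc.1 hcd.1 hcd.2.2.symm hab.2.2
    hcd.2.1.ne hac had hbd

omit [Fintype V] [DecidableEq V] [DecidableRel G.Adj] in
theorem noPathFive_of_houseFree (hG : (thetaGraph 1 2 3).Free G) (u : V) :
    NoPathFive (linkGraph G u) := fun _ _ _ _ _ hab hbc hcd _ hac had _ hbd _ _ =>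
  no_pathFour_of_houseFree hG hab hbc hcd hac had hbd

theorem IsTriangleComponent.inNbrs_center (hG : (thetaGraph 1 2 3).Free G) {u c p q : V}
    (h : IsTriangleComponent (linkGraph G u) c p q) : inNbrs G u c = {p, q} := by
  ext z
  rw [← linkGraph_adj h.hcp.2.1, Finset.mem_insert, Finset.mem_singleton]
  constructor
  · intro hz
    by_contra! hcon
    exact no_pathFour_of_houseFree hG hz.symm h.hcp h.hpq hcon.1 hcon.2 h.hcq.ne
  · rintro (rfl | rfl)
    exacts [h.hcp, h.hcq]

/-- In a house-free graph, an outer neighbour of a vertex on a triangle of the link has no other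
neighbour in the link. -/
theorem inNbrs_outer_of_triangle (hG : (thetaGraph 1 2 3).Free G) {u p s t w : V}
    (hs : (linkGraph G u).Adj p s) (ht : (linkGraph G u).Adj p t) (hst : s ≠ t)
    (hw : w ∈ outNbrs G u p) : inNbrs G u w = {p} := by
  rw [mem_outNbrs] at hw
  obtain ⟨hpw, hwu, huw⟩ := hw
  have key : ∀ z t, (linkGraph G u).Adj p t → G.Adj w z → G.Adj u z → z ≠ p → t ≠ z → False := by
    intro z t ht hwz huz hzp htz
    have wt : w ≠ t := by rintro rfl; exact huw ht.2.2
    exact no_house_of_free hG p t u z w ht.1 ht.2.2.symm huz hwz.symm hpw.symm ht.2.1.symm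
      hzp.symm htz wt.symm hwu.symm
  ext z
  rw [mem_inNbrs, Finset.mem_singleton]
  refine ⟨fun ⟨hwz, huz⟩ => ?_, fun hz => hz ▸ ⟨hpw.symm, hs.2.1⟩⟩
  by_contra hzp
  by_cases hsz : s = z
  · exact key z t ht hwz huz hzp (hsz ▸ hst.symm)
  · exact key z s hs hwz huz hzp hsz

/-- Either no edge has both ends outside the closed neighbourhood of `u`, or the degree sum
there is at least two. -/
theorem outNbrs_eq_empty_or_two_le_sum (u : V) :
    (∀ w ∈ outer G u, outNbrs G u w = ∅) ∨
      2 ≤ ∑ w ∈ outer G u, ((outNbrs G u w).card : ℝ) := by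
  by_cases h : ∀ w ∈ outer G u, outNbrs G u w = ∅
  · exact Or.inl h
  · right
    push Not at h
    obtain ⟨w, hw, z, hz⟩ := h
    have hz' := mem_outNbrs.1 hz
    have hwz : w ∈ outNbrs G u z := mem_outNbrs.2 ⟨hz'.1.symm, mem_outer.1 hw⟩
    have hsub : ({w, z} : Finset V) ⊆ outer G u := by
      intro y hy
      rw [Finset.mem_insert, Finset.mem_singleton] at hy
      rcases hy with rfl | rfl
      exacts [hw, mem_outer.2 hz'.2]
    refine le_trans ?_ (Finset.sum_le_sum_of_subset_of_nonneg hsub fun _ _ _ => by positivity)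
    rw [Finset.sum_pair hz'.1.ne]
    have h1 : (1 : ℝ) ≤ (outNbrs G u w).card := by
      exact_mod_cast Finset.card_pos.2 ⟨z, hz⟩
    have h2 : (1 : ℝ) ≤ (outNbrs G u z).card := by
      exact_mod_cast Finset.card_pos.2 ⟨w, hwz⟩
    linarith

namespace IsPerronVector
variable {lam : ℝ} {u : V} {x : V → ℝ} (hx : IsPerronVector G lam u x)
include hx

/-- Nonnegativity would force all three entries to be `1` and the loss at `p` to vanish. As `lam >
3`, the equation at `p` needs an outer neighbour; having zero loss and only `p` in the link, that
neighbour would give `lam ≤ 1`. -/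
theorem sum_gain_triangle_neg (hlam : 3 < lam) (hG : (thetaGraph 1 2 3).Free G) {c p q : V}
    (h : IsTriangleComponent (linkGraph G u) c p q) :
    ∑ v ∈ insert c (inNbrs G u c), gain G u x v < 0 := by
  have hle := hx.sum_gain_triangle_le h
  rw [h.inNbrs_center hG, Finset.card_pair h.hpq.ne] at hle
  push_cast at hle
  rw [h.inNbrs_center hG]
  have hp := hx.le_one p
  have hq := hx.le_one q
  have hc := hx.le_one c
  have lp := hx.lossAt_nonneg p
  have lq := hx.lossAt_nonneg q
  by_contra! hcon
  have hp1 : x p = 1 := by linarith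
  have hq1 : x q = 1 := by linarith
  have hc1 : x c = 1 := by linarith
  have hl : lossAt G u x p = 0 := by linarith
  have he := hx.eig_nbr h.hcp.2.2
  rw [h.inNbrs_p, Finset.sum_pair h.hcq.ne, hp1, hq1, hc1] at he
  by_cases h0 : outNbrs G u p = ∅
  · rw [h0, Finset.sum_empty] at he
    linarith
  · obtain ⟨w, hw⟩ := Finset.nonempty_iff_ne_empty.2 h0
    have hw0 := (Finset.sum_eq_zero_iff_of_nonneg (fun v _ => hx.outerLoss_nonneg v)).1 hl w hw
    have hin := inNbrs_outer_of_triangle hG h.hcp.symm h.hpq h.hcq.ne hw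
    have hwle := hx.lam_mul_le (mem_outer.2 (mem_outNbrs.1 hw).2)
    unfold outerLoss at hw0
    rw [hin] at hw0 hwle
    simp only [Finset.card_singleton, Nat.cast_one] at hw0 hwle
    have h3 : (0 : ℝ) ≤ (outNbrs G u w).card := by positivity
    have hxw := hx.le_one w
    have hw1 : x w = 1 := by linarith
    rw [hw1] at hwle
    linarith

/-- The spectral count fails when all components of the link are triangles or isolated vertices. -/
theorem count_lt_of_triangles (hlam : 3 < lam) (hlam8 : 7 ≤ lam ^ 2 - lam) {D : Finset V}
    (hDu : ∀ v ∈ D, G.Adj u v) (hD0 : ∀ v, G.Adj u v → v ∉ D → inNbrs G u v = ∅)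
    (hD2 : ∀ v ∈ D, (inNbrs G u v).card = 2)
    (hDout : ∀ v ∈ D, ∀ w ∈ outNbrs G u v, (inNbrs G u w).card = 1)
    (hcard : D.card = 0 ∨ D.card = 3 ∨ 6 ≤ D.card) :
    lam ^ 2 - lam < G.edgeFinset.card - 1 := by
  by_contra! hm
  have hDN : D ⊆ G.neighborFinset u := fun v hv => by simpa using hDu v hv
  have restrict : ∀ g : V → ℝ, (∑ v ∈ G.neighborFinset u, ((inNbrs G u v).card : ℝ) * g v)
      = 2 * ∑ v ∈ D, g v := by
    intro g
    rw [Finset.mul_sum, ← Finset.sum_subset hDN]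
    · exact Finset.sum_congr rfl fun v hv => by rw [hD2 v hv]; norm_num
    · intro v hv hvD
      rw [hD0 v (by simpa using hv) hvD]
      simp
  have hcount := hx.sq_sub_eq
  have hdeg := two_mul_card_edgeFinset G u
  have r1 := restrict x
  have r2 := restrict fun _ => 1
  simp only [mul_one, Finset.sum_const, nsmul_eq_mul] at r2
  have hW0 : 0 ≤ ∑ w ∈ outer G u, ((outNbrs G u w).card : ℝ) :=
    Finset.sum_nonneg fun _ _ => by positivity
  have hK0 : 0 ≤ ∑ v ∈ G.neighborFinset u, ((outNbrs G u v).card : ℝ) :=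
    Finset.sum_nonneg fun _ _ => by positivity
  have hDcard : (D.card : ℝ) ≤ (G.neighborFinset u).card := by
    exact_mod_cast Finset.card_le_card hDN
  rw [r1, r2] at hcount
  rw [r2] at hdeg
  have hmn : 2 * (D.card : ℝ) ≤ G.edgeFinset.card := by linarith
  -- the eigenvalue equation summed over `D`
  have heig : lam * ∑ v ∈ D, x v
      = D.card + 2 * ∑ v ∈ D, x v + ∑ v ∈ D, ∑ w ∈ outNbrs G u v, x w := by
    have h1 := sum_inNbrs_comm (G := G) u x
    rw [r1, ← Finset.sum_subset hDN] at h1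
    · rw [Finset.mul_sum, Finset.sum_congr rfl fun v hv => hx.eig_nbr (hDu v hv),
        Finset.sum_add_distrib, Finset.sum_add_distrib, h1]
      simp
    · intro v hv hvD
      rw [hD0 v (by simpa using hv) hvD]
      simp
  have hrest : ∑ v ∈ G.neighborFinset u \ D, ∑ w ∈ outNbrs G u v, x w
      ≤ ∑ v ∈ G.neighborFinset u \ D, ((outNbrs G u v).card : ℝ) :=
    Finset.sum_le_sum fun v _ => hx.sum_le_card _
  have hsplit1 := Finset.sum_sdiff (f := fun v => ∑ w ∈ outNbrs G u v, x w) hDN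
  have hsplit2 := Finset.sum_sdiff (f := fun v => ((outNbrs G u v).card : ℝ)) hDN
  have hA : ∑ v ∈ D, ∑ w ∈ outNbrs G u v, x w ≤ ∑ v ∈ D, ((outNbrs G u v).card : ℝ) :=
    Finset.sum_le_sum fun v _ => hx.sum_le_card _
  have hSn := hx.sum_le_card D
  have hSl : ∑ v ∈ D, x v ≤ lam := by
    rw [← hx.sum_nbrs]
    exact Finset.sum_le_sum_of_subset_of_nonneg hDN fun v _ _ => hx.nonneg v
  rcases outNbrs_eq_empty_or_two_le_sum (G := G) u with hE | hE
  · -- no edges outside the closed neighbourhood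
    have hAl : lam * ∑ v ∈ D, ∑ w ∈ outNbrs G u v, x w ≤ ∑ v ∈ D, ((outNbrs G u v).card : ℝ) := by
      rw [Finset.mul_sum]
      refine Finset.sum_le_sum fun v hv => ?_
      rw [Finset.mul_sum]
      refine (Finset.sum_le_card_nsmul _ _ 1 fun w hw => ?_).trans_eq (by simp)
      have hwo := mem_outer.2 (mem_outNbrs.1 hw).2
      have := hx.lam_mul_le hwo
      rw [hE w hwo, hDout v hv w hw] at this
      simpa using this
    have hKD0 : 0 ≤ ∑ v ∈ D, ((outNbrs G u v).card : ℝ) :=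
      Finset.sum_nonneg fun _ _ => by positivity
    exact triangle_count_false hlam hlam8 (by linarith) heig hAl hKD0 (by linarith) hcard
  -- The outer degree sum, at least `2`, cancels the `1` in the count, so every other estimate is
  -- sharp. A vertex of `D` then has an outer neighbour `w` with `x w = 1` and outer degree at most
  -- `2`, whence `lam ≤ 3`.
  · have hSn' : (D.card : ℝ) = ∑ v ∈ D, x v := by linarith
    have hSl' : lam = ∑ v ∈ D, x v := by linarith
    have hW : ∑ w ∈ outer G u, ((outNbrs G u w).card : ℝ) = 2 := by linarith
    have hAK : ∑ v ∈ D, ∑ w ∈ outNbrs G u v, (1 - x w) = 0 := by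
      simp only [Finset.sum_sub_distrib, Finset.sum_const, nsmul_eq_mul, mul_one]
      linarith
    have hApos : 0 < ∑ v ∈ D, ∑ w ∈ outNbrs G u v, x w := by
      have := mul_lt_mul_of_pos_right hlam (by linarith : 0 < ∑ v ∈ D, x v)
      linarith
    obtain ⟨v, hv, hvpos⟩ := Finset.exists_lt_of_sum_lt (f := fun _ => (0 : ℝ))
      (by simpa using hApos)
    obtain ⟨w, hw, -⟩ := Finset.exists_lt_of_sum_lt (f := fun _ => (0 : ℝ)) (by simpa using hvpos)
    have h1 := (Finset.sum_eq_zero_iff_of_nonneg fun v _ =>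
      Finset.sum_nonneg fun w _ => by linarith [hx.le_one w]).1 hAK v hv
    have h2 := (Finset.sum_eq_zero_iff_of_nonneg fun w _ => by linarith [hx.le_one w]).1 h1 w hw
    have hwo := mem_outer.2 (mem_outNbrs.1 hw).2
    have h3 := hx.lam_mul_le hwo
    rw [hDout v hv w hw, show x w = 1 by linarith] at h3
    have h4 : ((outNbrs G u w).card : ℝ) ≤ 2 := hW ▸
      Finset.single_le_sum (f := fun w => ((outNbrs G u w).card : ℝ))
        (fun _ _ => by positivity) hwo
    push_cast at h3
    linarith

theorem houseFree_extremal (hlam : 3 < lam) (hlam8 : 7 ≤ lam ^ 2 - lam)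
    (hG : (thetaGraph 1 2 3).Free G)
    (hiso : ∀ v : V, ∃ w : V, G.Adj v w)
    (hm : (G.edgeFinset.card : ℝ) - 1 ≤ lam ^ 2 - lam) :
    lam ^ 2 - lam = G.edgeFinset.card - 1 ∧
      ∃ c, G.Adj u c ∧ ∀ v w, G.Adj v w ↔ v ≠ w ∧ (v = u ∨ v = c ∨ w = u ∨ w = c) := by
  have h5 := noPathFive_of_houseFree hG u
  have noquad : ∀ a b c d, ¬ IsQuadComponent (linkGraph G u) a b c d := fun a b c d h =>
    no_pathFour_of_houseFree hG h.hab h.hbc h.hcd h.hac h.hda.ne.symm h.hbd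
  have hneg : ∀ v, G.Adj u v → ∃ T, IsLinkComponent G u T ∧ v ∈ T ∧
      ∑ y ∈ T, gain G u x y < 0 := by
    intro v hv
    rcases h5.classify v with h | ⟨a, b, c, d, h, -⟩ | ⟨c, p, q, h, hm⟩ | ⟨c, d, h, hm⟩
    · exact ⟨{v}, isLinkComponent_singleton hv h, by simp,
        by simpa using hx.gain_neg_of_isolated hv h⟩
    · exact (noquad a b c d h).elim
    · refine ⟨_, h.isLinkComponent, ?_, hx.sum_gain_triangle_neg hlam hG h⟩
      rwa [Finset.mem_insert, ← linkGraph_adj h.hcp.2.1]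
    · refine ⟨_, h.isLinkComponent, ?_, (hx.sum_gain_tree_le h).trans_lt (by norm_num)⟩
      rwa [Finset.mem_union, ← linkGraph_adj h.hcd.2.1, ← linkGraph_adj h.hcd.2.2]
  by_cases hex : ∃ c d, IsTreeComponent (linkGraph G u) c d
  · obtain ⟨c, d, h⟩ := hex
    refine hx.rigidity hlam hiso h hneg ?_ hm
    -- If `e` is the centre next to the leaf `y`, then `y e u z w` is a five-cycle with chord `y u`.
    intro w y z hw hwy hwz hyz hy hyc hyd hz hzc hzd
    obtain ⟨hwu, huw⟩ := mem_outer.1 hw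
    have huz : G.Adj u z := by rcases hz with hz | hz <;> exact hz.2.2
    have key : ∀ e, (linkGraph G u).Adj e y → z ≠ e → False := by
      intro e he hze
      have we : w ≠ e := by rintro rfl; exact huw he.2.1
      exact no_house_of_free hG y e u z w he.1.symm he.2.1.symm huz hwz.symm hwy
        he.2.2.symm hyz hze.symm we.symm hwu.symm
    rcases hy with hy | hy
    exacts [key c hy hzc, key d hy hzd]
  · exfalso
    push Not at hex
    -- every nonisolated vertex of the link lies on a triangle component
    have htri : ∀ v, (inNbrs G u v).Nonempty → G.Adj u v →
        ∃ c p q, IsTriangleComponent (linkGraph G u) c p q ∧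
          v ∈ ({c, p, q} : Finset V) := by
      rintro v ⟨w, hw⟩ hv
      rw [← linkGraph_adj hv] at hw
      rcases h5.classify v with h | ⟨a, b, c, d, h, -⟩ | ⟨c, p, q, h, hm⟩ | ⟨c, d, h, -⟩
      · exact (h w hw).elim
      · exact (noquad a b c d h).elim
      · refine ⟨c, p, q, h, ?_⟩
        rwa [← h.inNbrs_center hG, Finset.mem_insert, ← linkGraph_adj h.hcp.2.1]
      · exact (hex c d h).elim
    have hall : ∀ c p q, IsTriangleComponent (linkGraph G u) c p q → ∀ v ∈ ({c, p, q} : Finset V),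
        ∃ s t, s ≠ t ∧ (linkGraph G u).Adj v s ∧ (linkGraph G u).Adj v t ∧
          inNbrs G u v = {s, t} := by
      intro c p q h v hv
      simp only [Finset.mem_insert, Finset.mem_singleton] at hv
      rcases hv with rfl | rfl | rfl
      · exact ⟨p, q, h.hpq.ne, h.hcp, h.hcq, h.inNbrs_center hG⟩
      · exact ⟨c, q, h.hcq.ne, h.hcp.symm, h.hpq, h.inNbrs_p⟩
      · exact ⟨c, p, h.hcp.ne, h.hcq.symm, h.hpq.symm, h.swap.inNbrs_p⟩
    set D := (G.neighborFinset u).filter fun v => (inNbrs G u v).Nonempty with hD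
    have hmemD : ∀ v, v ∈ D ↔ G.Adj u v ∧ (inNbrs G u v).Nonempty := by simp [hD]
    have hsubD : ∀ c p q, IsTriangleComponent (linkGraph G u) c p q →
        ({c, p, q} : Finset V) ⊆ D := by
      intro c p q h v hv
      obtain ⟨s, t, -, hs, -⟩ := hall c p q h v hv
      exact (hmemD v).2 ⟨hs.2.1, s, (linkGraph_adj hs.2.1).1 hs⟩
    have hcard3 : ∀ c p q, IsTriangleComponent (linkGraph G u) c p q →
        ({c, p, q} : Finset V).card = 3 := fun c p q h =>
      Finset.card_eq_three.2 ⟨c, p, q, h.hcp.ne, h.hcq.ne, h.hpq.ne, rfl⟩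
    have hcomp : ∀ c p q, IsTriangleComponent (linkGraph G u) c p q →
        IsLinkComponent G u {c, p, q} := by
      intro c p q h
      have := h.isLinkComponent
      rwa [h.inNbrs_center hG] at this
    refine absurd hm (not_le.2 (hx.count_lt_of_triangles hlam hlam8 (D := D)
      (fun v hv => ((hmemD v).1 hv).1) ?_ ?_ ?_ ?_))
    · intro v hv hvD
      by_contra h0
      exact hvD ((hmemD v).2 ⟨hv, Finset.nonempty_iff_ne_empty.2 h0⟩)
    · intro v hv
      obtain ⟨hvu, hne⟩ := (hmemD v).1 hv
      obtain ⟨c, p, q, h, hvT⟩ := htri v hne hvu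
      obtain ⟨s, t, hst, -, -, heq⟩ := hall c p q h v hvT
      rw [heq, Finset.card_pair hst]
    · intro v hv w hw
      obtain ⟨hvu, hne⟩ := (hmemD v).1 hv
      obtain ⟨c, p, q, h, hvT⟩ := htri v hne hvu
      obtain ⟨s, t, hst, hs, ht, -⟩ := hall c p q h v hvT
      rw [inNbrs_outer_of_triangle hG hs ht hst hw, Finset.card_singleton]
    -- `D` is a disjoint union of triangles, so two of them already give six vertices.
    · rcases D.eq_empty_or_nonempty with h0 | ⟨v, hv⟩
      · exact Or.inl (by rw [h0, Finset.card_empty])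
      right
      obtain ⟨hvu, hne⟩ := (hmemD v).1 hv
      obtain ⟨c, p, q, h, -⟩ := htri v hne hvu
      rcases (D \ {c, p, q}).eq_empty_or_nonempty with h0 | ⟨v', hv'⟩
      · left
        rw [← hcard3 c p q h]
        exact congrArg _ ((Finset.sdiff_eq_empty_iff_subset.1 h0).antisymm (hsubD c p q h))
      · right
        rw [Finset.mem_sdiff] at hv'
        obtain ⟨hvu', hne'⟩ := (hmemD v').1 hv'.1
        obtain ⟨c', p', q', h', hvT'⟩ := htri v' hne' hvu'
        have hdisj : Disjoint ({c, p, q} : Finset V) {c', p', q'} := by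
          rw [Finset.disjoint_left]
          intro y hy hy'
          exact hv'.2 ((hcomp c' p' q' h').subset_of_closed (hcomp c p q h).closed hy' hy hvT')
        have := Finset.card_le_card (Finset.union_subset (hsubD c p q h) (hsubD c' p' q' h'))
        rwa [Finset.card_union_of_disjoint hdisj, hcard3 c p q h, hcard3 c' p' q' h'] at this

end IsPerronVector
end House

/-! ### The complete split graph and the equality case. -/

section Extremal
variable {V : Type*} [Fintype V] [DecidableEq V] {G : SimpleGraph V} [DecidableRel G.Adj]

omit [DecidableRel G.Adj] in
theorem nonempty_iso_completeSplitGraph {u c : V} (huc : u ≠ c)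
    (h : ∀ v w, G.Adj v w ↔ v ≠ w ∧ (v = u ∨ v = c ∨ w = u ∨ w = c)) :
    Nonempty (G ≃g completeSplitGraph (Fintype.card V) 2) := by
  classical
  have hcard : Fintype.card {v // v = u ∨ v = c} = 2 := by
    rw [Fintype.card_subtype]
    have : (Finset.univ.filter fun v => v = u ∨ v = c) = {u, c} := by ext; simp
    rw [this, Finset.card_pair huc]
  have hcard' : Fintype.card {v // ¬ (v = u ∨ v = c)} = Fintype.card V - 2 := by
    rw [Fintype.card_subtype_compl, hcard]
  let e : V ≃ Fin 2 ⊕ Fin (Fintype.card V - 2) :=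
    (Equiv.sumCompl fun v => v = u ∨ v = c).symm.trans
      (Equiv.sumCongr (Fintype.equivFinOfCardEq hcard) (Fintype.equivFinOfCardEq hcard'))
  refine ⟨(RelIso.mk e.symm ?_ : completeSplitGraph (Fintype.card V) 2 ≃g G).symm⟩
  have hl : ∀ i, e.symm (Sum.inl i) = u ∨ e.symm (Sum.inl i) = c := fun i =>
    ((Fintype.equivFinOfCardEq hcard).symm i).2
  have hr : ∀ i, ¬ (e.symm (Sum.inr i) = u ∨ e.symm (Sum.inr i) = c) := fun i =>
    ((Fintype.equivFinOfCardEq hcard').symm i).2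
  intro s t
  rw [h]
  rcases s with i | i <;> rcases t with j | j
  · have := hl i
    simp only [completeSplitGraph, graphJoin, ne_eq, EmbeddingLike.apply_eq_iff_eq, Sum.inl.injEq]
    simp
    tauto
  · have := hl i
    simp [completeSplitGraph, graphJoin]
    tauto
  · have := hl j
    simp [completeSplitGraph, graphJoin]
    tauto
  · have h1 := hr i
    have h2 := hr j
    simp [completeSplitGraph, graphJoin]
    tauto

theorem two_mul_card_of_split {u c : V} (huc : u ≠ c)
    (h : ∀ v w, G.Adj v w ↔ v ≠ w ∧ (v = u ∨ v = c ∨ w = u ∨ w = c)) :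
    2 * Fintype.card V = G.edgeFinset.card + 3 := by
  have hsum := G.sum_degrees_eq_twice_card_edges
  have hu : G.degree u = Fintype.card V - 1 := by
    rw [← G.card_neighborFinset_eq_degree, show G.neighborFinset u = Finset.univ.erase u by
      ext w; simp [h]; tauto]
    simp
  have hc : G.degree c = Fintype.card V - 1 := by
    rw [← G.card_neighborFinset_eq_degree, show G.neighborFinset c = Finset.univ.erase c by
      ext w; simp [h]; tauto]
    simp
  have hcc : c ∈ Finset.univ.erase u := by simp [huc.symm]
  rw [← Finset.add_sum_erase _ _ (Finset.mem_univ u), ← Finset.add_sum_erase _ _ hcc, hu, hc,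
    Finset.sum_congr rfl (g := fun _ => 2)] at hsum
  · rw [Finset.sum_const, Finset.card_erase_of_mem hcc,
      Finset.card_erase_of_mem (Finset.mem_univ u), Finset.card_univ, smul_eq_mul] at hsum
    have : 2 ≤ Fintype.card V := by
      rw [← Finset.card_pair huc, ← Finset.card_univ]
      exact Finset.card_le_card (Finset.subset_univ _)
    omega
  · intro v hv
    simp only [Finset.mem_erase, Finset.mem_univ, and_true] at hv
    rw [← G.card_neighborFinset_eq_degree, show G.neighborFinset v = {u, c} by
      ext w
      simp only [SimpleGraph.mem_neighborFinset, h, Finset.mem_insert, Finset.mem_singleton]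
      constructor
      · rintro ⟨-, h1 | h1 | h1 | h1⟩
        exacts [(hv.2 h1).elim, (hv.1 h1).elim, Or.inl h1, Or.inr h1]
      · rintro (rfl | rfl)
        exacts [⟨hv.2, by simp⟩, ⟨hv.1, by simp⟩], Finset.card_pair huc]

theorem le_graphSpectralRadius_of_iso [Nonempty V] {n : ℕ} (hn : 2 ≤ n) (k : ℝ)
    (hpos : 0 < k) (heq : k ^ 2 - k = 2 * (n - 2))
    (φ : G ≃g completeSplitGraph n 2) : k ≤ graphSpectralRadius G := by
  classical
  -- The value `2 / k` is forced at the independent vertices; the equation at the other two is then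
  -- `k ^ 2 - k = 2 * (n - 2)`.
  set y : Fin 2 ⊕ Fin (n - 2) → ℝ := Sum.elim (fun _ => 1) (fun _ => 2 / k) with hy
  have key : ∀ s, ∑ t, (if (completeSplitGraph n 2).Adj s t then y t else 0) = k * y s := by
    intro s
    rw [Fintype.sum_sum_type]
    rcases s with i | i
    · have h1 : ∑ t : Fin 2, (if (completeSplitGraph n 2).Adj (Sum.inl i) (Sum.inl t)
          then y (Sum.inl t) else 0) = 1 := by
        fin_cases i <;> simp [completeSplitGraph, graphJoin, Fin.sum_univ_two, hy]
      rw [h1]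
      simp [completeSplitGraph, graphJoin, hy]
      rw [Nat.cast_sub hn]
      field_simp
      push_cast
      linarith
    · simp [completeSplitGraph, graphJoin, hy]
      field_simp
  refine le_graphSpectralRadius G k (fun v => y (φ v)) ?_ fun v => ?_
  · intro h
    have := congrFun h (φ.symm (Sum.inl 0))
    simp [hy] at this
  · rw [← key, ← φ.toEquiv.sum_comp, SimpleGraph.neighborFinset_eq_filter, Finset.sum_filter]
    refine Finset.sum_congr rfl fun w _ => ?_
    have := φ.map_adj_iff (v := v) (w := w)
    by_cases h : G.Adj v w
    · simpa [h] using fun h' => (h' (this.2 h)).elim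
    · simpa [h] using fun h' => (h (this.1 h')).elim

/-- The bound and its equality case, given that `lam ^ 2 - lam ≥ m - 1` forces the complete split
graph. -/
theorem spectralRadius_bound_of_extremal [Nonempty V]
    (hm : 8 ≤ G.edgeFinset.card)
    (h : (G.edgeFinset.card : ℝ) - 1 ≤ graphSpectralRadius G ^ 2 - graphSpectralRadius G →
      graphSpectralRadius G ^ 2 - graphSpectralRadius G = G.edgeFinset.card - 1 ∧
      ∃ u c, G.Adj u c ∧ ∀ v w, G.Adj v w ↔ v ≠ w ∧ (v = u ∨ v = c ∨ w = u ∨ w = c)) :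
    graphSpectralRadius G ≤ (1 + Real.sqrt (4 * (G.edgeFinset.card : ℝ) - 3)) / 2 ∧
      (graphSpectralRadius G = (1 + Real.sqrt (4 * (G.edgeFinset.card : ℝ) - 3)) / 2 ↔
        ∃ n : ℕ, 2 * n = G.edgeFinset.card + 3 ∧ Nonempty (G ≃g completeSplitGraph n 2)) := by
  have hm' : (8 : ℝ) ≤ G.edgeFinset.card := by exact_mod_cast hm
  have hs := Real.sq_sqrt (show (0 : ℝ) ≤ 4 * (G.edgeFinset.card : ℝ) - 3 by linarith)
  have hs0 := Real.sqrt_nonneg (4 * (G.edgeFinset.card : ℝ) - 3)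
  set s := Real.sqrt (4 * (G.edgeFinset.card : ℝ) - 3)
  have hle : graphSpectralRadius G ≤ (1 + s) / 2 := by
    by_contra! hlt
    have h1 : (G.edgeFinset.card : ℝ) - 1 < graphSpectralRadius G ^ 2 - graphSpectralRadius G := by
      nlinarith
    exact h1.ne (h h1.le).1.symm
  refine ⟨hle, fun heq => ?_, ?_⟩
  · obtain ⟨-, u, c, huc, hadj⟩ := h (by rw [heq]; nlinarith)
    exact ⟨Fintype.card V, two_mul_card_of_split huc.ne hadj,
      nonempty_iso_completeSplitGraph huc.ne hadj⟩
  · rintro ⟨n, hn, ⟨φ⟩⟩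
    refine le_antisymm hle (le_graphSpectralRadius_of_iso (by omega) _ (by linarith) ?_ φ)
    have : 2 * (n : ℝ) = G.edgeFinset.card + 3 := by exact_mod_cast hn
    nlinarith

end Extremal

theorem theorem1p1 {V : Type*} [Fintype V] [DecidableEq V] (G : SimpleGraph V)
    [DecidableRel G.Adj] (m : ℕ) (hm : G.edgeFinset.card = m)
    (hiso : ∀ v : V, ∃ w : V, G.Adj v w) :
    (8 ≤ m → (thetaGraph 1 2 3).Free G →
      graphSpectralRadius G ≤ (1 + Real.sqrt (4 * (m : ℝ) - 3)) / 2 ∧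
      (graphSpectralRadius G = (1 + Real.sqrt (4 * (m : ℝ) - 3)) / 2 ↔
        ∃ n : ℕ, 2 * n = m + 3 ∧ Nonempty (G ≃g completeSplitGraph n 2))) ∧
    (22 ≤ m → (thetaGraph 1 2 4).Free G →
      graphSpectralRadius G ≤ (1 + Real.sqrt (4 * (m : ℝ) - 3)) / 2 ∧
      (graphSpectralRadius G = (1 + Real.sqrt (4 * (m : ℝ) - 3)) / 2 ↔
        ∃ n : ℕ, 2 * n = m + 3 ∧ Nonempty (G ≃g completeSplitGraph n 2))) := by
  subst hm
  have hV : 8 ≤ G.edgeFinset.card → Nonempty V := by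
    intro h
    obtain ⟨e, -⟩ := Finset.card_pos.1 (by omega : 0 < G.edgeFinset.card)
    exact ⟨e.out.1⟩
  refine ⟨fun h8 hG => ?_, fun h22 hG => ?_⟩
  · have := hV h8
    obtain ⟨h0, u, x, hx⟩ := exists_isPerronVector (G := G)
    have h8' : (8 : ℝ) ≤ G.edgeFinset.card := by exact_mod_cast h8
    refine spectralRadius_bound_of_extremal h8 fun h => ?_
    -- `lam ^ 2 - lam ≥ 7 > 6` gives `lam > 3`; in the other case `lam ^ 2 - lam ≥ 21 > 20` gives
    -- `lam > 5`.
    obtain ⟨h1, h2⟩ := hx.houseFree_extremal (by nlinarith) (by linarith) hG hiso h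
    exact ⟨h1, u, h2⟩
  · have := hV (by omega)
    obtain ⟨h0, u, x, hx⟩ := exists_isPerronVector (G := G)
    have h22' : (22 : ℝ) ≤ G.edgeFinset.card := by exact_mod_cast h22
    refine spectralRadius_bound_of_extremal (by omega) fun h => ?_
    obtain ⟨h1, h2⟩ := hx.hexagonFree_extremal (by nlinarith) hG hiso h
    exact ⟨h1, u, h2⟩
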